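/- Let $0<\alpha<2$, $\beta\in[-1,1]$, $\sigma>0$. Put $w(\alpha,x)=\tan(\pi\alpha/2)$ if $\alpha\neq1$ and $w(1,x)=-\frac2\pi\ln|x|$. Let $(\varepsilon_t)_{t\in\mathbb Z}$ be i.i.d. $\mathcal S(\alpha,\beta,\sigma,0)$ variables, i.e. $\mathbb E[e^{iu\varepsilon_t}]=\exp\{-\sigma^\alpha|u|^\alpha(1-i\beta\,\mathrm{sign}(u)\,w(\alpha,u))\}$ for all $u\in\mathbb R$. Let $(d_k)_{k\in\mathbb Z}$ be a real sequence that is not identically zero, such that - if $\alpha\ne1$ or $(\alpha,\beta)=(1,0)$: $\sum_{k}|d_k|^s<\infty$ for some $s\in(0,\alpha)\cap[0,1]$; - if $\alpha=1$ and $\beta\neq0$: $\sum_k|d_k|<\infty$ and $\sum_k|d_k|\,\big|\ln|d_k|\big|<\infty$ (with $0\,|\ln 0|=0$). Let $X_t=\sum_{k\in\mathbb Z}d_k\varepsilon_{t+k}$ and, for integers $m\ge0$, $h\ge1$, let $\boldsymbol X_t=(X_{t-m},\ldots,X_t,X_{t+1},\ldots,X_{t+h})$ and $\boldsymbol d_k=(d_{k+m},\ldots,d_k,d_{k-1},\ldots,d_{k-h})$.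 Let $\|\cdot\|_e$ be the Euclidean norm and $\|\cdot\|$ a seminorm on $\mathbb R^{m+h+1}$ such that $\|(x_{-m},\ldots,x_0,x_1,\ldots,x_h)\|=0$ if and only if $x_{-m}=\cdots=x_0=0$, and let $C^{\|\cdot\|}=\{s\in\mathbb R^{m+h+1}:\|s\|=1\}$. The vector $\boldsymbol X_t$ is called representable on $C^{\|\cdot\|}$ in the following cases. - If $\boldsymbol X_t$ is not symmetric (its law differs from that of $-\boldsymbol X_t$): there are a vector $\boldsymbol\mu\in\mathbb R^{m+h+1}$ and a Borel measure $\Gamma$ on $C^{\|\cdot\|}$ such that, for all $u$, $\int|\langle u,s\rangle|^\alpha\,\Gamma(ds)<\infty$ if $\alpha\neq1$, respectively $\int|\langle u,s\rangle|\,\big|\ln|\langle u,s\rangle|\big|\,\Gamma(ds)<\infty$ if $\alpha=1$, and $$\mathbb E\big[e^{i\langle u,\boldsymbol X_t\rangle}\big]=\exp\Big\{-\int_{C^{\|\cdot\|}}|\langle u,s\rangle|^\alpha\big(1-i\,\mathrm{sign}(\langle u,s\rangle)\,w(\alpha,\langle u,s\rangle)\big)\Gamma(ds)+i\langle u,\boldsymbol\mu\rangle\Big\}.$$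 - If $\boldsymbol X_t$ is symmetric: there is a symmetric Borel measure $\Gamma$ on $C^{\|\cdot\|}$ such that, for all $u$, $\int|\langle u,s\rangle|^\alpha\,\Gamma(ds)<\infty$ and $\mathbb E[e^{i\langle u,\boldsymbol X_t\rangle}]=\exp\{-\int_{C^{\|\cdot\|}}|\langle u,s\rangle|^\alpha\,\Gamma(ds)\}$. Consider the condition $$(\ast)\qquad \forall k\in\mathbb Z:\quad d_{k+m}=\cdots=d_k=0\ \Longrightarrow\ d_\ell=0\ \text{ for all } \ell\le k-1 .$$ (i) If $\alpha\neq1$, or $(\alpha,\beta)=(1,0)$, or $\boldsymbol X_t$ is symmetric, then $\boldsymbol X_t$ is representable on $C^{\|\cdot\|}$ if and only if $(\ast)$ holds. (ii) If $\alpha=1$, $\beta\ne0$ and $\boldsymbol X_t$ is not symmetric, then $\boldsymbol X_t$ is representable on $C^{\|\cdot\|}$ if and only if $(\ast)$ holds and $$\sum_{k\in\mathbb Z}\|\boldsymbol d_k\|_e\,\Big|\ln\big(\|\boldsymbol d_k\|/\|\boldsymbol d_k\|_e\big)\Big|<\infty ,$$ where the terms with $\boldsymbol d_k=\boldsymbol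 0$ are read as $0$. -/

import Mathlib

open MeasureTheory ProbabilityTheory

noncomputable section

/-- The function `w(α, x)`: `tan (π α / 2)` if `α ≠ 1`, and `-(2/π) ln |x|` if `α = 1`. -/
def stableW (α x : ℝ) : ℝ :=
  if α = 1 then -(2 / Real.pi) * Real.log |x| else Real.tan (Real.pi * α / 2)

/-- `|x|^α (1 - i b sign(x) w(α, x))`. -/
def stableExponent (α b x : ℝ) : ℂ :=
  ((|x| ^ α : ℝ) : ℂ) * (1 - Complex.I * ((b * Real.sign x * stableW α x : ℝ) : ℂ))

/-- The real random variables `ε t`, `t ∈ ℤ`, are i.i.d. with the stable law `S(α, β, σ, 0)`, which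
is given by its characteristic function. -/
structure IsStableNoise {Ω : Type*} [MeasurableSpace Ω] (P : Measure Ω) (α β σ : ℝ)
    (ε : ℤ → Ω → ℝ) : Prop where
  measurable : ∀ t, Measurable (ε t)
  indep : iIndepFun ε P
  law : ∀ t u, charFun (P.map (ε t)) u =
    Complex.exp (-(((σ ^ α : ℝ) : ℂ) * stableExponent α β u))

/-- Conditions on the coefficients of the moving average. In the case `α = 1`, `β ≠ 0`, the
summability of `|d k|` only rules out sequences that do not tend to `0`. -/
structure IsMACoeff (α β : ℝ) (d : ℤ → ℝ) : Prop where
  ne_zero : ∃ k, d k ≠ 0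
  summable_rpow : α ≠ 1 ∨ β = 0 →
    ∃ s : ℝ, 0 < s ∧ s < α ∧ s ≤ 1 ∧ Summable fun k => |d k| ^ s
  summable_log : α = 1 → β ≠ 0 →
    (Summable fun k => |d k|) ∧ Summable fun k => |d k| * |Real.log (|d k|)|

/-- The moving average `X t = ∑ₖ d k * ε (t + k)`. -/
def movingAverage {Ω : Type*} (d : ℤ → ℝ) (ε : ℤ → Ω → ℝ) (t : ℤ) (ω : Ω) : ℝ :=
  ∑' k : ℤ, d k * ε (t + k) ω

/-- The path `(X (t - m), …, X t, X (t + 1), …, X (t + h))`. -/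
def pathVector {Ω : Type*} (X : ℤ → Ω → ℝ) (m h : ℕ) (t : ℤ) (ω : Ω) :
    EuclideanSpace ℝ (Fin (m + h + 1)) :=
  WithLp.toLp 2 fun j => X (t - (m : ℤ) + ((j : ℕ) : ℤ)) ω

/-- The vector `(d (k + m), …, d k, d (k - 1), …, d (k - h))`. -/
def coeffVector (d : ℤ → ℝ) (m h : ℕ) (k : ℤ) : EuclideanSpace ℝ (Fin (m + h + 1)) :=
  WithLp.toLp 2 fun j => d (k + (m : ℤ) - ((j : ℕ) : ℤ))

/-- A measure on a vector space is symmetric if it is invariant under `x ↦ -x`. -/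
def IsSymmetricMeasure {E : Type*} [Neg E] [MeasurableSpace E] (μ : Measure E) : Prop :=
  μ.map (fun x => -x) = μ

/-- The unit cylinder of a seminorm. -/
def unitCylinder {n : ℕ} (p : Seminorm ℝ (EuclideanSpace ℝ (Fin n))) :
    Set (EuclideanSpace ℝ (Fin n)) :=
  {s | p s = 1}

/-- Representability on the unit cylinder, for a non-symmetric `α`-stable law. A Borel measure on
the cylinder is a Borel measure on the whole space that gives no mass to the complement. -/
def IsRepresentableAsymm {n : ℕ} (α : ℝ) (p : Seminorm ℝ (EuclideanSpace ℝ (Fin n)))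
    (law : Measure (EuclideanSpace ℝ (Fin n))) : Prop :=
  ∃ (Γ : Measure (EuclideanSpace ℝ (Fin n))) (μ₀ : EuclideanSpace ℝ (Fin n)),
    Γ (unitCylinder p)ᶜ = 0 ∧
    (α ≠ 1 → ∀ u, ∫⁻ s, ENNReal.ofReal (|inner ℝ u s| ^ α) ∂Γ < ⊤) ∧
    (α = 1 → ∀ u, ∫⁻ s, ENNReal.ofReal (|inner ℝ u s| * |Real.log (|inner ℝ u s|)|) ∂Γ < ⊤) ∧
    ∀ u, charFun law u =
      Complex.exp (-(∫ s, stableExponent α 1 (inner ℝ u s) ∂Γ) +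
        Complex.I * ((inner ℝ u μ₀ : ℝ) : ℂ))

/-- Representability on the unit cylinder, for a symmetric `α`-stable law. -/
def IsRepresentableSymm {n : ℕ} (α : ℝ) (p : Seminorm ℝ (EuclideanSpace ℝ (Fin n)))
    (law : Measure (EuclideanSpace ℝ (Fin n))) : Prop :=
  ∃ Γ : Measure (EuclideanSpace ℝ (Fin n)),
    Γ (unitCylinder p)ᶜ = 0 ∧
    IsSymmetricMeasure Γ ∧
    (∀ u, ∫⁻ s, ENNReal.ofReal (|inner ℝ u s| ^ α) ∂Γ < ⊤) ∧
    ∀ u, charFun law u = Complex.exp (-((∫ s, |inner ℝ u s| ^ α ∂Γ : ℝ) : ℂ))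

/-- Representability of an `α`-stable random vector, with the given law, on the unit cylinder of the
seminorm `p`. -/
def IsRepresentable {n : ℕ} (α : ℝ) (p : Seminorm ℝ (EuclideanSpace ℝ (Fin n)))
    (law : Measure (EuclideanSpace ℝ (Fin n))) : Prop :=
  (¬ IsSymmetricMeasure law → IsRepresentableAsymm α p law) ∧
    (IsSymmetricMeasure law → IsRepresentableSymm α p law)

/-- Whenever `d (k + m) = … = d k = 0`, all earlier coefficients vanish. -/
def NoInteriorGap (d : ℤ → ℝ) (m : ℕ) : Prop :=
  ∀ k : ℤ, (∀ i : ℤ, k ≤ i → i ≤ k + (m : ℤ) → d i = 0) → ∀ l : ℤ, l ≤ k - 1 → d l = 0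

end

open scoped Topology

/-! ### Tails of stable laws on the line -/

/-! Write `c k` for the coefficient vector at `k`. The path is almost surely the sum of the vectors
`ε (k + t) • c k`, so its characteristic function is the exponential of `-σ ^ α * ∑ k,
stableExponent α β ⟪u, c k⟫`. It thus has a natural spectral measure off the cylinder, `N = ∑ k, σ ^
α • δ (c k)`, and the question is whether this can be moved to the cylinder. The seminorm only sees
the first `m + 1` coordinates, and `(∗)` says that `p (c k) = 0` forces `c k = 0`
(`noInteriorGap_iff`).

Sufficiency: each atom is projected radially to the cylinder and gets the extra mass `p (c k) ^ α`;
skewness `β` is produced by splitting it between `c k` and `-c k` in the ratio `1 + β : 1 - β`. For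
`α ≠ 1` the exponent is homogeneous and nothing else happens. For `α = 1` rescaling costs a term
linear in `u` with coefficient `log (p (c k))` (`stableExponent_mul`); these terms add up to a drift
vector when `∑ |log (p (c k))| * ‖c k‖` converges, which is the extra condition of (ii) up to
summable terms. A symmetric law only involves `|⟪u, c k⟫| ^ α`, so no drift appears.

Necessity does not go through uniqueness of spectral measures. Taking moduli of characteristic
functions shows that a representing `Γ` and `N` have the same integrals of `|⟪u, ·⟫| ^ α` for all
`u`, hence the same integrals of second differences of `|·| ^ α`. Let `T` be the projection on the
observed coordinates. The second difference at `R * ⟪v, T s⟫` with step `⟪w, s⟫` tends, as `R → ∞`,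
to `2 * |⟪w, s⟫| ^ α` where `⟪v, T s⟫ = 0` and to `0` elsewhere. Since `T s ≠ 0` on the cylinder, a
Gaussian choice of `v` makes the limit vanish for `Γ`, so it vanishes for `N`, which has therefore
no atom `x ≠ 0` with `T x = 0` (`ae_inner_eq_zero_of_moments_eq`).

For `α = 1` the second difference is `2 * (|⟪w, s⟫| - |⟪v, s⟫|)₊`. Summing over dyadic multiples of
`v` produces a logarithm: averaged over Gaussian `v`, the sum is controlled for `Γ` by its
logarithmic moment (`exists_tsum_lintegral_pos_part_lt_top`), while for `N` it dominates `|⟪w, c k⟫|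
* log (|⟪w, c k⟫| / p (c k))` up to summable terms (`exists_summable_bound_mul_log`). -/

lemma stableExponent_re (α b x : ℝ) : (stableExponent α b x).re = |x| ^ α := by
  simp [stableExponent, Complex.mul_re]

lemma stableExponent_im (α b x : ℝ) :
    (stableExponent α b x).im = -(|x| ^ α * (b * Real.sign x * stableW α x)) := by
  simp [stableExponent, Complex.mul_im]

lemma re_exp_neg_stableExponent (α b c t : ℝ) :
    (Complex.exp (-((c : ℂ) * stableExponent α b t))).re =
      Real.exp (-(c * |t| ^ α)) * Real.cos (c * (|t| ^ α * (b * Real.sign t * stableW α t))) := by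
  rw [Complex.exp_re]
  congr 2
  · rw [Complex.neg_re, Complex.re_ofReal_mul, stableExponent_re]
  · rw [Complex.neg_im, Complex.im_ofReal_mul, stableExponent_im]
    ring

lemma one_sub_exp_mul_cos_le {a : ℝ} (ha : 0 ≤ a) (b : ℝ) :
    1 - Real.exp (-a) * Real.cos b ≤ a + b ^ 2 / 2 := by
  have h1 := Real.one_sub_sq_div_two_le_cos (x := b)
  have h2 := Real.add_one_le_exp (-a)
  have h3 : Real.exp (-a) ≤ 1 := Real.exp_le_one_iff.2 (by linarith)
  have h4 := Real.exp_pos (-a)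
  nlinarith [Real.cos_le_one b]

/-- The phase enters `1 - Re φ` only through its square. At `α = 1` this absorbs the logarithm,
because `t * log t ^ 2` stays bounded near `0`. -/
lemma exists_sq_rpow_mul_stableW_le {α : ℝ} (hα : 0 < α) :
    ∃ K, 0 ≤ K ∧ ∀ t, 0 < t → t ≤ 2 → (t ^ α * stableW α t) ^ 2 ≤ K * t ^ α := by
  by_cases h1 : α = 1
  · subst h1
    refine ⟨(2 / Real.pi) ^ 2 * 4, by positivity, fun t ht ht2 => ?_⟩
    have key : t * Real.log t ^ 2 ≤ 4 := by
      rcases le_or_gt t 1 with h | h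
      · have := (Real.abs_log_mul_self_rpow_lt t (1 / 2) ht h (by norm_num)).le
        have h2 : (Real.log t * t ^ (1 / 2 : ℝ)) ^ 2 ≤ 2 ^ 2 := by
          rw [← sq_abs]
          exact pow_le_pow_left₀ (abs_nonneg _) (by linarith) 2
        rw [mul_pow, ← Real.sqrt_eq_rpow, Real.sq_sqrt ht.le] at h2
        linarith
      · have h2 := Real.log_le_sub_one_of_pos ht
        have h3 := Real.log_pos h
        have : Real.log t ^ 2 ≤ 1 := by nlinarith
        nlinarith
    simp only [stableW, if_true, Real.rpow_one, abs_of_pos ht]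
    have : (t * (-(2 / Real.pi) * Real.log t)) ^ 2 =
        (2 / Real.pi) ^ 2 * t * (t * Real.log t ^ 2) := by ring
    rw [this, mul_right_comm]
    gcongr
  · refine ⟨2 ^ α * stableW α 1 ^ 2, by positivity, fun t ht ht2 => ?_⟩
    have hw : stableW α t = stableW α 1 := by simp [stableW, h1]
    have : t ^ α ≤ 2 ^ α := Real.rpow_le_rpow ht.le ht2 hα.le
    have h0 : 0 ≤ t ^ α := by positivity
    rw [hw, mul_pow]
    have : (t ^ α) ^ 2 ≤ 2 ^ α * t ^ α := by nlinarith
    calc (t ^ α) ^ 2 * stableW α 1 ^ 2 ≤ (2 ^ α * t ^ α) * stableW α 1 ^ 2 := by gcongr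
      _ = _ := by ring

lemma exists_one_sub_re_exp_le {α c : ℝ} (hα : 0 < α) (hc : 0 ≤ c) (b : ℝ) :
    ∃ K, 0 ≤ K ∧ ∀ t, 0 < t → t ≤ 2 →
      1 - (Complex.exp (-((c : ℂ) * stableExponent α b t))).re ≤ K * t ^ α := by
  obtain ⟨K, hK, h⟩ := exists_sq_rpow_mul_stableW_le hα
  refine ⟨c + (c * b) ^ 2 * K / 2, by positivity, fun t ht ht2 => ?_⟩
  rw [re_exp_neg_stableExponent, abs_of_pos ht, Real.sign_of_pos ht]
  refine (one_sub_exp_mul_cos_le (by positivity) _).trans ?_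
  have := mul_le_mul_of_nonneg_left (h t ht ht2) (sq_nonneg (c * b))
  nlinarith

/-- Pairing `t` with `-t` cancels the imaginary part. For `α = 1` that part can be of order `t *
|log t|` and would cost a logarithm in the tail estimate. -/
lemma norm_integral_one_sub_charFun_le {ν : Measure ℝ} [IsProbabilityMeasure ν] {a B : ℝ}
    (ha : 0 ≤ a) (h : ∀ t, 0 < t → t ≤ a → 1 - (charFun ν t).re ≤ B) :
    ‖∫ t in -a..a, 1 - charFun ν t‖ ≤ 2 * B * a := by
  have hi : ∀ x y : ℝ, IntervalIntegrable (fun t => 1 - charFun ν t) volume x y := fun x y =>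
    intervalIntegrable_const.sub intervalIntegrable_charFun
  have h1 : ∫ t in -a..0, 1 - charFun ν t = ∫ t in (0 : ℝ)..a, 1 - charFun ν (-t) := by
    rw [intervalIntegral.integral_comp_neg (fun t => 1 - charFun ν t)]
    simp
  rw [← intervalIntegral.integral_add_adjacent_intervals (hi (-a) 0) (hi 0 a), h1,
    ← intervalIntegral.integral_add _ (hi 0 a)]
  · have := intervalIntegral.norm_integral_le_of_norm_le_const (a := 0) (b := a) (C := 2 * B)
      (f := fun t => 1 - charFun ν (-t) + (1 - charFun ν t)) ?_
    · simpa [abs_of_nonneg ha] using this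
    · intro t ht
      rw [Set.uIoc_of_le ha] at ht
      have e : 1 - charFun ν (-t) + (1 - charFun ν t) = ((2 * (1 - (charFun ν t).re) : ℝ) : ℂ) := by
        rw [charFun_neg]
        apply Complex.ext
        · simp; ring
        · simp
      have hn : (charFun ν t).re ≤ 1 := (Complex.re_le_norm _).trans (norm_charFun_le_one t)
      rw [e, Complex.norm_real, Real.norm_of_nonneg (by linarith)]
      linarith [h t ht.1 ht.2]
  · simpa using (hi 0 (-a)).comp_sub_left 0

lemma exists_tail_le {α c b : ℝ} (hα : 0 < α) (hc : 0 ≤ c) (ν : Measure ℝ) [IsProbabilityMeasure ν]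
    (hν : ∀ u, charFun ν u = Complex.exp (-((c : ℂ) * stableExponent α b u))) :
    ∃ K, 0 ≤ K ∧ ∀ r, 1 ≤ r → ν {x | r < |x|} ≤ ENNReal.ofReal (K * r ^ (-α)) := by
  obtain ⟨K, hK, h⟩ := exists_one_sub_re_exp_le hα hc b
  refine ⟨2 * K * 2 ^ α, by positivity, fun r hr => ?_⟩
  have hr0 : 0 < r := by linarith
  -- The truncation inequality integrates over `|t| ≤ 2 / r`; for `r ≥ 1` this stays in the range
  -- where `1 - Re φ` is at most `K * |t| ^ α`.
  have hr2 : 2 * r⁻¹ ≤ 2 := by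
    have := inv_le_one_of_one_le₀ hr
    linarith
  have h1 := measureReal_abs_gt_le_integral_charFun (μ := ν) hr0
  have h2 := norm_integral_one_sub_charFun_le (ν := ν) (a := 2 * r⁻¹) (B := K * (2 * r⁻¹) ^ α)
    (by positivity) (fun t ht hta => by
      rw [hν]
      refine (h t ht (hta.trans hr2)).trans ?_
      gcongr)
  rw [show -(2 * r⁻¹) = -2 * r⁻¹ by ring] at h2
  rw [← ENNReal.ofReal_toReal (measure_ne_top ν _)]
  apply ENNReal.ofReal_le_ofReal
  calc (ν {x | r < |x|}).toReal ≤ 2⁻¹ * r * (2 * (K * (2 * r⁻¹) ^ α) * (2 * r⁻¹)) :=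
        h1.trans (by gcongr)
    _ = 2 * K * 2 ^ α * r ^ (-α) := by
        rw [Real.mul_rpow (by norm_num) (by positivity), Real.inv_rpow hr0.le, Real.rpow_neg hr0.le]
        field_simp

lemma lintegral_rpow_abs_lt_top_of_tail {α K : ℝ} (ν : Measure ℝ) [IsProbabilityMeasure ν]
    (h : ∀ r, 1 ≤ r → ν {x | r < |x|} ≤ ENNReal.ofReal (K * r ^ (-α))) {s : ℝ} (hs : 0 < s)
    (hsα : s < α) : ∫⁻ x, ENNReal.ofReal (|x| ^ s) ∂ν < ⊤ := by
  rw [lintegral_rpow_eq_lintegral_meas_lt_mul ν (Filter.Eventually.of_forall fun x => abs_nonneg x)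
    (by fun_prop) hs]
  refine ENNReal.mul_lt_top ENNReal.ofReal_lt_top ?_
  rw [← Set.Ioc_union_Ioi_eq_Ioi (zero_le_one' ℝ)]
  refine (lintegral_union_le _ _ _).trans_lt (ENNReal.add_lt_top.2 ⟨?_, ?_⟩)
  · have hi : IntegrableOn (fun t : ℝ => t ^ (s - 1)) (Set.Ioc 0 1) := by
      rw [← intervalIntegrable_iff_integrableOn_Ioc_of_le zero_le_one]
      exact intervalIntegral.intervalIntegrable_rpow' (by linarith)
    refine lt_of_le_of_lt ?_ hi.lintegral_lt_top
    refine lintegral_mono fun t => ?_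
    exact mul_le_of_le_one_left (by positivity) prob_le_one
  · have hi : IntegrableOn (fun t : ℝ => K * t ^ (s - 1 - α)) (Set.Ioi 1) :=
      (integrableOn_Ioi_rpow_of_lt (by linarith) one_pos).const_mul K
    refine lt_of_le_of_lt ?_ hi.lintegral_lt_top
    refine setLIntegral_mono' measurableSet_Ioi fun t ht => ?_
    have ht0 : (0 : ℝ) < t := lt_trans one_pos ht
    refine (mul_le_mul_left (h t (le_of_lt ht)) _).trans ?_
    rw [← ENNReal.ofReal_mul' (by positivity), mul_assoc, ← Real.rpow_add ht0]
    apply le_of_eq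
    congr 3
    ring

/-- A tail of order `1 / r` gives no first moment. After truncation at `1`, the tail integral of `K
* |c| / t` over `|c| < t ≤ 1` gives the term `|c| * |log |c||`, which is what the coefficient
condition for `α = 1`, `β ≠ 0` makes summable. -/
lemma lintegral_min_abs_mul_one_le_of_tail {K : ℝ} (hK : 0 ≤ K) (ν : Measure ℝ)
    [IsProbabilityMeasure ν]
    (h : ∀ r, 1 ≤ r → ν {x | r < |x|} ≤ ENNReal.ofReal (K * r⁻¹)) (c : ℝ) :
    ∫⁻ x, ENNReal.ofReal (min (|c * x|) 1) ∂ν ≤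
      ENNReal.ofReal (|c| + K * (|c| * |Real.log (|c|)|)) := by
  rcases eq_or_ne c 0 with rfl | hc
  · simp
  have hc0 : 0 < |c| := abs_pos.2 hc
  rcases le_or_gt 1 |c| with h1 | h1
  · calc ∫⁻ x, ENNReal.ofReal (min (|c * x|) 1) ∂ν ≤ ∫⁻ x, 1 ∂ν := by
          refine lintegral_mono fun x => ?_
          rw [← ENNReal.ofReal_one]
          exact ENNReal.ofReal_le_ofReal (min_le_right _ _)
      _ = ENNReal.ofReal 1 := by simp
      _ ≤ _ := by
          apply ENNReal.ofReal_le_ofReal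
          have : 0 ≤ K * (|c| * |Real.log (|c|)|) := by positivity
          linarith
  rw [lintegral_eq_lintegral_meas_lt ν
    (Filter.Eventually.of_forall fun x => le_min (abs_nonneg _) zero_le_one) (by fun_prop),
    ← Set.Ioc_union_Ioi_eq_Ioi hc0.le, ENNReal.ofReal_add hc0.le (by positivity)]
  refine (lintegral_union_le _ _ _).trans (add_le_add ?_ ?_)
  · calc ∫⁻ t in Set.Ioc 0 |c|, ν {x | t < min (|c * x|) 1} ≤ ∫⁻ t in Set.Ioc 0 |c|, 1 :=
          lintegral_mono fun t => prob_le_one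
      _ = _ := by simp
  · rw [← Set.Ioc_union_Ioi_eq_Ioi h1.le]
    refine (lintegral_union_le _ _ _).trans ?_
    have z : ∫⁻ t in Set.Ioi (1 : ℝ), ν {x | t < min (|c * x|) 1} = 0 := by
      rw [setLIntegral_congr_fun (g := fun _ => 0) measurableSet_Ioi]
      · simp
      · intro t ht
        have : {x | t < min (|c * x|) 1} = ∅ := by
          ext x
          have := Set.mem_Ioi.1 ht
          simp only [Set.mem_ofPred_eq, lt_min_iff, Set.mem_empty_iff_false, iff_false, not_and]
          intro _; linarith
        simp only [this, measure_empty]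
    rw [z, add_zero]
    have hi : IntervalIntegrable (fun t : ℝ => K * |c| * t⁻¹) volume |c| 1 :=
      (intervalIntegral.intervalIntegrable_inv (fun t ht => by
        rw [Set.uIcc_of_le h1.le] at ht
        exact (hc0.trans_le ht.1).ne') continuousOn_id).const_mul _
    calc ∫⁻ t in Set.Ioc |c| 1, ν {x | t < min (|c * x|) 1}
        ≤ ∫⁻ t in Set.Ioc |c| 1, ENNReal.ofReal (K * |c| * t⁻¹) := by
          refine setLIntegral_mono' measurableSet_Ioc fun t ht => ?_
          refine (measure_mono ?_).trans ((h (t / |c|) ?_).trans (le_of_eq ?_))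
          · intro x hx
            have := (lt_min_iff.1 (Set.mem_ofPred_eq ▸ hx)).1
            rw [abs_mul] at this
            rw [Set.mem_ofPred_eq, div_lt_iff₀ hc0]
            linarith
          · rw [le_div_iff₀ hc0, one_mul]
            exact ht.1.le
          · rw [inv_div]
            congr 1
            ring
      _ = ENNReal.ofReal (∫ t in Set.Ioc |c| 1, K * |c| * t⁻¹) := by
          rw [ofReal_integral_eq_lintegral_ofReal]
          · exact (intervalIntegrable_iff_integrableOn_Ioc_of_le h1.le).1 hi
          · refine (ae_restrict_iff' measurableSet_Ioc).2 (Filter.Eventually.of_forall fun t ht => ?_)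
            have : 0 < t := hc0.trans ht.1
            positivity
      _ = _ := by
          rw [← intervalIntegral.integral_of_le h1.le, intervalIntegral.integral_const_mul,
            integral_inv_of_pos hc0 one_pos, Real.log_div one_ne_zero hc0.ne', Real.log_one,
            abs_of_neg (Real.log_neg hc0 h1)]
          congr 1
          ring

/-! ### The law of the path -/

lemma IsStableNoise.map_eq {Ω : Type*} [MeasurableSpace Ω] {P : Measure Ω} {α β σ : ℝ}
    {ε : ℤ → Ω → ℝ} (hε : IsStableNoise P α β σ ε) [IsProbabilityMeasure P] (t : ℤ) :
    P.map (ε t) = P.map (ε 0) := by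
  have := Measure.isProbabilityMeasure_map (μ := P) (hε.measurable t).aemeasurable
  have := Measure.isProbabilityMeasure_map (μ := P) (hε.measurable 0).aemeasurable
  refine Measure.ext_of_charFun ?_
  ext u
  rw [hε.law, hε.law]

lemma ae_summable_of_tsum_lintegral_ne_top {Ω ι : Type*} [Countable ι] [MeasurableSpace Ω]
    {P : Measure Ω} {f : ι → Ω → ℝ} (hf : ∀ k, Measurable (f k)) (h0 : ∀ k ω, 0 ≤ f k ω)
    (h : ∑' k, ∫⁻ ω, ENNReal.ofReal (f k ω) ∂P ≠ ⊤) : ∀ᵐ ω ∂P, Summable fun k => f k ω := by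
  rw [← lintegral_tsum fun k => (hf k).ennreal_ofReal.aemeasurable] at h
  filter_upwards [ae_lt_top' (AEMeasurable.tsum fun k => (hf k).ennreal_ofReal.aemeasurable) h]
    with ω hω
  refine (ENNReal.summable_toReal hω.ne).congr fun k => ?_
  rw [ENNReal.toReal_ofReal (h0 k ω)]

lemma tsum_ofReal_ne_top {ι : Type*} {f : ι → ℝ} (h0 : ∀ k, 0 ≤ f k) (h : Summable f) :
    ∑' k, ENNReal.ofReal (f k) ≠ ⊤ := by
  rw [← ENNReal.ofReal_tsum_of_nonneg h0 h]
  exact ENNReal.ofReal_ne_top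

lemma eventually_abs_le_one_of_summable_rpow {ι : Type*} {x : ι → ℝ} {s : ℝ} (hs : 0 < s)
    (h : Summable fun k => |x k| ^ s) : ∀ᶠ k in Filter.cofinite, |x k| ≤ 1 := by
  filter_upwards [h.tendsto_cofinite_zero.eventually_le_const one_pos] with k hk
  by_contra! hx
  exact absurd hk (not_le.2 (Real.one_lt_rpow hx hs))

lemma summable_abs_rpow_of_le {ι : Type*} {x : ι → ℝ} {s r : ℝ} (hs : 0 < s) (hsr : s ≤ r)
    (h : Summable fun k => |x k| ^ s) : Summable fun k => |x k| ^ r := by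
  refine Summable.of_norm_bounded_eventually h ?_
  filter_upwards [eventually_abs_le_one_of_summable_rpow hs h] with k hk
  rw [Real.norm_of_nonneg (by positivity)]
  exact Real.rpow_le_rpow_of_exponent_ge_of_imp (abs_nonneg _) hk hsr
    fun _ h => absurd h (hs.trans_le hsr).ne'

lemma summable_of_summable_min_one {ι : Type*} {x : ι → ℝ}
    (h : Summable fun k => min |x k| 1) : Summable x := by
  refine Summable.of_norm_bounded_eventually h ?_
  filter_upwards [h.tendsto_cofinite_zero.eventually_lt_const one_pos] with k hk
  rcases min_lt_iff.1 hk with h1 | h1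
  · rw [min_eq_left h1.le, Real.norm_eq_abs]
  · exact absurd h1 (lt_irrefl _)

/-- Absolute convergence follows from a finite sum of expectations: of `s`-th powers with `s ≤ 1` in
the first case, of the terms truncated at `1` in the logarithmic case. -/
lemma ae_summable_movingAverage {Ω : Type*} [MeasurableSpace Ω] {P : Measure Ω}
    [IsProbabilityMeasure P] {α β σ : ℝ} (hα : 0 < α) (hσ : 0 < σ) {ε : ℤ → Ω → ℝ}
    (hε : IsStableNoise P α β σ ε) {d : ℤ → ℝ} (hd : IsMACoeff α β d) (τ : ℤ) :
    ∀ᵐ ω ∂P, Summable fun k => d k * ε (τ + k) ω := by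
  have := Measure.isProbabilityMeasure_map (μ := P) (hε.measurable 0).aemeasurable
  obtain ⟨K, hK, htail⟩ := exists_tail_le (c := σ ^ α) hα (by positivity) (P.map (ε 0)) (hε.law 0)
  have hmap : ∀ k (g : ℝ → ENNReal), Measurable g →
      ∫⁻ ω, g (ε k ω) ∂P = ∫⁻ x, g x ∂(P.map (ε 0)) := fun k g hg => by
    rw [← hε.map_eq k, lintegral_map hg (hε.measurable k)]
  have hme := hε.measurable
  by_cases hc : α ≠ 1 ∨ β = 0
  · obtain ⟨s, hs, hsα, hs1, hsum⟩ := hd.summable_rpow hc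
    have hfin := lintegral_rpow_abs_lt_top_of_tail _ htail hs hsα
    have := ae_summable_of_tsum_lintegral_ne_top (P := P)
      (f := fun k ω => |d k * ε (τ + k) ω| ^ s)
      (fun k => by have := hme (τ + k); fun_prop)
      (fun k ω => by positivity) (by
        have : ∀ k, ∫⁻ ω, ENNReal.ofReal (|d k * ε (τ + k) ω| ^ s) ∂P =
            ENNReal.ofReal (|d k| ^ s) * ∫⁻ x, ENNReal.ofReal (|x| ^ s) ∂(P.map (ε 0)) := by
          intro k
          rw [← hmap (τ + k) _ (by fun_prop), ← lintegral_const_mul _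
            (by have := hme (τ + k); fun_prop)]
          refine lintegral_congr fun ω => ?_
          rw [abs_mul, Real.mul_rpow (abs_nonneg _) (abs_nonneg _),
            ENNReal.ofReal_mul (by positivity)]
        simp_rw [this]
        rw [ENNReal.tsum_mul_right]
        exact ENNReal.mul_ne_top (tsum_ofReal_ne_top (fun k => by positivity) hsum) hfin.ne)
    filter_upwards [this] with ω hω
    have := summable_abs_rpow_of_le hs hs1 hω
    simp only [Real.rpow_one] at this
    exact this.of_abs
  · push Not at hc
    obtain ⟨rfl, hβ⟩ := hc
    obtain ⟨h1, h2⟩ := hd.summable_log rfl hβ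
    have hb := lintegral_min_abs_mul_one_le_of_tail hK (P.map (ε 0)) (fun r hr => by
      simpa [Real.rpow_neg_one] using htail r hr)
    have := ae_summable_of_tsum_lintegral_ne_top (P := P)
      (f := fun k ω => min |d k * ε (τ + k) ω| 1)
      (fun k => by have := hme (τ + k); fun_prop)
      (fun k ω => by positivity) (by
        refine ne_top_of_le_ne_top (tsum_ofReal_ne_top (fun k => ?_) (h1.add (h2.mul_left K)))
          (ENNReal.tsum_le_tsum fun k => ?_)
        · positivity
        · rw [hmap (τ + k) (fun x => ENNReal.ofReal (min |d k * x| 1)) (by fun_prop)]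
          exact hb (d k))
    filter_upwards [this] with ω hω
    exact summable_of_summable_min_one hω

lemma ae_hasSum_pathVector {Ω : Type*} [MeasurableSpace Ω] {P : Measure Ω}
    [IsProbabilityMeasure P] {α β σ : ℝ} (hα : 0 < α) (hσ : 0 < σ) {ε : ℤ → Ω → ℝ}
    (hε : IsStableNoise P α β σ ε) {d : ℤ → ℝ} (hd : IsMACoeff α β d) (m h : ℕ) (t : ℤ) :
    ∀ᵐ ω ∂P, HasSum (fun i => ε (i + t) ω • coeffVector d m h i)
      (pathVector (movingAverage d ε) m h t ω) := by
  have := ae_all_iff.2 fun τ => ae_summable_movingAverage hα hσ hε hd τ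
  filter_upwards [this] with ω hω
  have key : HasSum (fun i => fun j : Fin (m + h + 1) => ε (i + t) ω * d (i + m - (j : ℕ)))
      (fun j => movingAverage d ε (t - (m : ℤ) + ((j : ℕ) : ℤ)) ω) := by
    rw [Pi.hasSum]
    intro j
    have h1 := (hω (t - (m : ℤ) + ((j : ℕ) : ℤ))).hasSum
    -- The substitution `k = i + m - j` makes the same noise variable `ε (i + t)` multiply the
    -- `i`-th term in every coordinate `j`.
    rw [← (Equiv.addRight ((m : ℤ) - (j : ℕ))).hasSum_iff] at h1
    have e : (fun i => ε (i + t) ω * d (i + m - (j : ℕ))) =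
        (fun k => d k * ε (t - m + (j : ℕ) + k) ω) ∘ Equiv.addRight ((m : ℤ) - (j : ℕ)) := by
      ext i
      simp only [Function.comp, Equiv.coe_addRight]
      rw [mul_comm]
      congr 2 <;> ring_nf
    rw [e]
    exact h1
  exact ((PiLp.continuousLinearEquiv 2 ℝ fun _ : Fin (m + h + 1) => ℝ).symm :
    (Fin (m + h + 1) → ℝ) →L[ℝ] EuclideanSpace ℝ (Fin (m + h + 1))).hasSum key

lemma aemeasurable_of_ae_hasSum {Ω E : Type*} [MeasurableSpace Ω] {P : Measure Ω}
    [NormedAddCommGroup E] [InnerProductSpace ℝ E] [MeasurableSpace E] [BorelSpace E]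
    [SecondCountableTopology E] {f : ℤ → Ω → E} (hf : ∀ i, Measurable (f i)) {V : Ω → E}
    (hV : ∀ᵐ ω ∂P, HasSum (fun i => f i ω) (V ω)) : AEMeasurable V P := by
  refine aemeasurable_of_tendsto_metrizable_ae (Filter.atTop : Filter (Finset ℤ))
    (f := fun s ω => ∑ i ∈ s, f i ω) (fun s => ?_) ?_
  · exact (Finset.measurable_fun_sum s fun i _ => hf i).aemeasurable
  · filter_upwards [hV] with ω hω
    simpa only [HasSum, SummationFilter.unconditional_filter] using hω

/-- Independence handles finite partial sums and dominated convergence the limit. Prescribing the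
exponents `z i` replaces an infinite product by a series and avoids complex logarithms. -/
lemma charFun_map_of_ae_hasSum {Ω E : Type*} [MeasurableSpace Ω] {P : Measure Ω}
    [IsProbabilityMeasure P] [NormedAddCommGroup E] [InnerProductSpace ℝ E] [MeasurableSpace E]
    [BorelSpace E] [SecondCountableTopology E] {ξ : ℤ → Ω → ℝ} (hξ : ∀ i, Measurable (ξ i))
    (hind : iIndepFun ξ P) {c : ℤ → E} {V : Ω → E}
    (hV : ∀ᵐ ω ∂P, HasSum (fun i => ξ i ω • c i) (V ω)) {u : E} {z : ℤ → ℂ}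
    (hz : ∀ i, charFun (P.map (ξ i)) (inner ℝ u (c i)) = Complex.exp (-z i)) (hs : Summable z) :
    charFun (P.map V) u = Complex.exp (-∑' i, z i) := by
  have hm : ∀ i, Measurable fun ω => ξ i ω • c i := fun i => (hξ i).smul_const _
  have hVm := aemeasurable_of_ae_hasSum hm hV
  have hfin : ∀ s : Finset ℤ, ∫ ω, Complex.exp ((inner ℝ (∑ i ∈ s, ξ i ω • c i) u : ℝ) *
      Complex.I) ∂P = Complex.exp (-∑ i ∈ s, z i) := by
    intro s
    have hind2 : iIndepFun (fun i ω => ξ i ω • c i) P :=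
      hind.comp (fun i x => x • c i) fun i => by fun_prop
    have h1 := (hind2.restrict s).charFun_map_fun_finsetSum_eq_prod
      (X := fun i ω => ξ i ω • c i) (fun i _ => (hm i).aemeasurable)
    have h2 := congrFun h1 u
    rw [charFun_apply, integral_map (Finset.measurable_fun_sum s fun i _ => hm i).aemeasurable
      (by fun_prop)] at h2
    rw [h2, Finset.prod_apply, ← Finset.sum_neg_distrib, Complex.exp_sum]
    refine Finset.prod_congr rfl fun i _ => ?_
    rw [← hz, charFun_apply, charFun_apply, integral_map (hm i).aemeasurable (by fun_prop),
      integral_map (hξ i).aemeasurable (by fun_prop)]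
    refine integral_congr_ae (Filter.Eventually.of_forall fun ω => ?_)
    simp only [real_inner_smul_left, real_inner_comm u (c i), real_inner_eq_re_inner]
    congr 2
    simp [mul_comm]
  have hlim : Filter.Tendsto (fun s : Finset ℤ => ∫ ω, Complex.exp
      ((inner ℝ (∑ i ∈ s, ξ i ω • c i) u : ℝ) * Complex.I) ∂P) Filter.atTop
      (𝓝 (∫ ω, Complex.exp ((inner ℝ (V ω) u : ℝ) * Complex.I) ∂P)) := by
    refine tendsto_integral_filter_of_dominated_convergence (fun _ => 1) ?_ ?_
      (integrable_const _) ?_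
    · refine Filter.Eventually.of_forall fun s => Measurable.aestronglyMeasurable ?_
      have := Finset.measurable_fun_sum s fun i _ => hm i
      fun_prop
    · refine Filter.Eventually.of_forall fun s => Filter.Eventually.of_forall fun ω => ?_
      rw [Complex.norm_exp_ofReal_mul_I]
    · filter_upwards [hV] with ω hω
      have h2 : Continuous fun x : E => Complex.exp ((inner ℝ x u : ℝ) * Complex.I) := by fun_prop
      exact (h2.tendsto (V ω)).comp
        (by simpa only [HasSum, SummationFilter.unconditional_filter] using hω)
  rw [charFun_apply, integral_map hVm (by fun_prop)]
  refine tendsto_nhds_unique hlim ?_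
  simp_rw [hfin]
  have := hs.hasSum
  simp only [HasSum, SummationFilter.unconditional_filter] at this
  exact (Complex.continuous_exp.tendsto _).comp this.neg

/-! ### The stable exponent -/

lemma stableExponent_zero {α : ℝ} (hα : 0 < α) (b : ℝ) : stableExponent α b 0 = 0 := by
  simp [stableExponent, Real.zero_rpow hα.ne']

/-- Only the sign changes under `x ↦ -x`, so any skewness is a mixture of the two totally skewed
exponents. This dictates the masses put on `c i` and `-c i`. -/
lemma stableExponent_eq_mixture (α b x : ℝ) :
    stableExponent α b x = ((1 + b) / 2 : ℝ) * stableExponent α 1 x +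
      ((1 - b) / 2 : ℝ) * stableExponent α 1 (-x) := by
  have h : Real.sign (-x) = -Real.sign x := Real.sign_neg
  simp only [stableExponent, abs_neg, h, stableW]
  push_cast
  ring

/-- The correction that the scaling of the stable exponent needs when `α = 1`. -/
noncomputable def logScale (α a : ℝ) : ℝ := if α = 1 then Real.log a else 0

/-- For `α = 1`, `log |a * x| = log a + log |x|` and `sign x * |x| = x`, so homogeneity fails by a
term linear in `x`. Such terms become drifts. -/
lemma stableExponent_mul {α : ℝ} (b : ℝ) {a : ℝ} (ha : 0 < a) (x : ℝ) :
    stableExponent α b (a * x) = (a ^ α : ℝ) * stableExponent α b x +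
      Complex.I * (b * (2 / Real.pi) * a * logScale α a * x : ℝ) := by
  have hs : Real.sign (a * x) = Real.sign x := by
    rcases lt_trichotomy x 0 with h | rfl | h
    · rw [Real.sign_of_neg h, Real.sign_of_neg (mul_neg_of_pos_of_neg ha h)]
    · simp
    · rw [Real.sign_of_pos h, Real.sign_of_pos (mul_pos ha h)]
  rcases eq_or_ne x 0 with rfl | hx
  · simp [stableExponent, mul_comm]
    rcases eq_or_ne α 0 with rfl | h
    · simp
    · simp [Real.zero_rpow h]
  have hp : |a * x| ^ α = a ^ α * |x| ^ α := by
    rw [abs_mul, abs_of_pos ha, Real.mul_rpow ha.le (abs_nonneg _)]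
  simp only [stableExponent, hs, hp, stableW, logScale]
  split_ifs with h
  · subst h
    have hx2 : x = Real.sign x * |x| := by
      rcases lt_or_gt_of_ne hx with h | h
      · rw [Real.sign_of_neg h, abs_of_neg h]; ring
      · rw [Real.sign_of_pos h, abs_of_pos h]; ring
    have hl : Real.log |a * x| = Real.log a + Real.log |x| := by
      rw [abs_mul, abs_of_pos ha, Real.log_mul ha.ne' (abs_ne_zero.2 hx)]
    rw [hl, Real.rpow_one, Real.rpow_one]
    nth_rewrite 7 [hx2]
    push_cast
    ring
  · push_cast
    ring

lemma norm_stableExponent_le (α b x : ℝ) :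
    ‖stableExponent α b x‖ ≤ |x| ^ α + |b| * (|x| ^ α * |stableW α x|) := by
  have h0 : 0 ≤ |x| ^ α := by positivity
  rw [stableExponent, norm_mul, Complex.norm_real, Real.norm_of_nonneg h0]
  have h1 : ‖1 - Complex.I * ((b * Real.sign x * stableW α x : ℝ) : ℂ)‖ ≤
      1 + |b| * |stableW α x| := by
    refine (norm_sub_le _ _).trans ?_
    rw [norm_one, norm_mul, Complex.norm_I, one_mul, Complex.norm_real, Real.norm_eq_abs, abs_mul,
      abs_mul]
    have : |Real.sign x| ≤ 1 := by
      rcases Real.sign_apply_eq x with h | h | h <;> simp [h]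
    gcongr
    nlinarith [abs_nonneg b]
  calc _ ≤ |x| ^ α * (1 + |b| * |stableW α x|) := by gcongr
    _ = _ := by ring

lemma rpow_mul_abs_stableW_eq {α : ℝ} (h : α = 1) (x : ℝ) :
    |x| ^ α * |stableW α x| = 2 / Real.pi * (|x| * |Real.log (|x|)|) := by
  subst h
  rw [stableW, if_pos rfl, Real.rpow_one, abs_mul, abs_neg,
    abs_of_pos (by positivity : 0 < 2 / Real.pi)]
  ring

lemma rpow_abs_le_norm_stableExponent (α b x : ℝ) : |x| ^ α ≤ ‖stableExponent α b x‖ := by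
  rw [← stableExponent_re α b x]
  exact Complex.re_le_norm _

lemma abs_mul_abs_log_le_norm_stableExponent (x : ℝ) :
    |x| * |Real.log (|x|)| ≤ Real.pi / 2 * ‖stableExponent 1 1 x‖ := by
  have h := Complex.abs_im_le_norm (stableExponent 1 1 x)
  have e : |(stableExponent 1 1 x).im| = 2 / Real.pi * (|x| * |Real.log (|x|)|) := by
    rw [← rpow_mul_abs_stableW_eq rfl, stableExponent_im, abs_neg, abs_mul, abs_mul, abs_mul,
      abs_one, one_mul, abs_of_nonneg (by positivity : 0 ≤ |x| ^ (1 : ℝ))]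
    rcases eq_or_ne x 0 with rfl | hx
    · simp
    · have : |Real.sign x| = 1 := by
        rcases Real.sign_apply_eq_of_ne_zero x hx with h | h <;> simp [h]
      rw [this, one_mul]
  rw [e] at h
  calc |x| * |Real.log (|x|)| = Real.pi / 2 * (2 / Real.pi * (|x| * |Real.log (|x|)|)) := by
        field_simp
    _ ≤ _ := by gcongr

lemma measurable_stableExponent (α b : ℝ) : Measurable (stableExponent α b) := by
  have h1 : Measurable Real.sign := by
    unfold Real.sign
    refine Measurable.ite (measurableSet_lt measurable_id measurable_const) measurable_const ?_
    exact Measurable.ite (measurableSet_lt measurable_const measurable_id) measurable_const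
      measurable_const
  have h2 : Measurable (stableW α) := by
    unfold stableW
    split_ifs
    · fun_prop
    · fun_prop
  unfold stableExponent
  fun_prop

lemma summable_stableExponent {ι : Type*} {α b : ℝ} {x : ι → ℝ}
    (h1 : Summable fun k => |x k| ^ α)
    (h2 : α = 1 → b ≠ 0 → Summable fun k => |x k| * |Real.log (|x k|)|) :
    Summable fun k => stableExponent α b (x k) := by
  refine Summable.of_norm_bounded ?_ fun k => norm_stableExponent_le α b (x k)
  refine h1.add ?_
  rcases eq_or_ne b 0 with rfl | hb
  · simp [summable_zero]
  refine Summable.mul_left _ ?_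
  rcases eq_or_ne α 1 with h | h
  · exact ((h2 h hb).mul_left (2 / Real.pi)).congr fun k => (rpow_mul_abs_stableW_eq h _).symm
  · refine (h1.mul_right (|stableW α 1|)).congr fun k => ?_
    simp only [stableW, h, if_false]

/-! ### Summability of linear functionals of the coefficients -/

/-- Since `x * |log x|` is not monotone, the comparison costs a linear term: with `y = r * x` and `r
≤ M`, it comes from the bound `1 + M ^ 2` for `r * |log r|`. -/
lemma abs_mul_log_le {x y M : ℝ} (hx : 0 ≤ x) (hy : 0 ≤ y) (hM : 0 ≤ M) (hyx : y ≤ M * x) :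
    y * |Real.log y| ≤ (1 + M ^ 2) * x + M * (x * |Real.log x|) := by
  rcases hy.eq_or_lt with rfl | hy0
  · simp
    positivity
  have hx : 0 < x := by
    by_contra! h
    nlinarith
  set r := y / x with hr
  have hr0 : 0 < r := by positivity
  have hy2 : y = r * x := by rw [hr]; field_simp
  have hrM : r ≤ M := by rwa [hr, div_le_iff₀ hx]
  have h1 : r * |Real.log r| ≤ 1 + M ^ 2 := by
    rcases le_or_gt r 1 with h | h
    · have := (Real.abs_log_mul_self_lt r hr0 h).le
      rw [abs_mul, abs_of_pos hr0] at this
      nlinarith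
    · rw [abs_of_pos (Real.log_pos h)]
      have := Real.log_le_sub_one_of_pos hr0
      nlinarith
  rw [hy2, Real.log_mul hr0.ne' hx.ne']
  have h2 := abs_add_le (Real.log r) (Real.log x)
  have h3 : 0 ≤ x * |Real.log x| := by positivity
  calc r * x * |Real.log r + Real.log x| ≤ r * x * (|Real.log r| + |Real.log x|) := by gcongr
    _ = x * (r * |Real.log r|) + r * (x * |Real.log x|) := by ring
    _ ≤ x * (1 + M ^ 2) + M * (x * |Real.log x|) := by gcongr
    _ = _ := by ring

lemma exists_norm_le_card_mul {n : ℕ} [NeZero n] (x : EuclideanSpace ℝ (Fin n)) :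
    ∃ j, ‖x‖ ≤ n * |x j| := by
  obtain ⟨j, -, hj⟩ := Finset.exists_max_image Finset.univ (fun j => |x j|) Finset.univ_nonempty
  refine ⟨j, ?_⟩
  have hn : (1 : ℝ) ≤ n := by exact_mod_cast NeZero.one_le
  rw [EuclideanSpace.norm_eq]
  apply Real.sqrt_le_iff.2 ⟨by positivity, ?_⟩
  calc ∑ i, ‖x i‖ ^ 2 ≤ ∑ _i : Fin n, |x j| ^ 2 := by
        gcongr with i
        exact hj i (Finset.mem_univ _)
    _ = n * |x j| ^ 2 := by simp
    _ ≤ (n * n) * |x j| ^ 2 := by gcongr; nlinarith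
    _ = _ := by ring

lemma summable_norm_rpow_of_coord {n : ℕ} [NeZero n] {ι : Type*} {α : ℝ} (hα : 0 < α)
    {c : ι → EuclideanSpace ℝ (Fin n)} (h : ∀ j, Summable fun k => |c k j| ^ α) :
    Summable fun k => ‖c k‖ ^ α := by
  refine Summable.of_nonneg_of_le (fun k => by positivity) (fun k => ?_)
    ((summable_sum fun j (_ : j ∈ Finset.univ) => h j).mul_left ((n : ℝ) ^ α))
  obtain ⟨j, hj⟩ := exists_norm_le_card_mul (c k)
  calc ‖c k‖ ^ α ≤ (n * |c k j|) ^ α := Real.rpow_le_rpow (norm_nonneg _) hj hα.le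
    _ = (n : ℝ) ^ α * |c k j| ^ α := Real.mul_rpow (by positivity) (abs_nonneg _)
    _ ≤ _ := by
        gcongr
        exact Finset.single_le_sum (f := fun j => |c k j| ^ α) (fun i _ => by positivity)
          (Finset.mem_univ j)

lemma summable_norm_mul_log_of_coord {n : ℕ} [NeZero n] {ι : Type*}
    {c : ι → EuclideanSpace ℝ (Fin n)} (h1 : ∀ j, Summable fun k => |c k j|)
    (h2 : ∀ j, Summable fun k => |c k j| * |Real.log (|c k j|)|) :
    Summable fun k => ‖c k‖ * |Real.log ‖c k‖| := by
  refine Summable.of_nonneg_of_le (fun k => by positivity) (fun k => ?_)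
    (summable_sum fun j (_ : j ∈ Finset.univ) =>
      ((h1 j).mul_left (1 + (n : ℝ) ^ 2)).add ((h2 j).mul_left (n : ℝ)))
  obtain ⟨j, hj⟩ := exists_norm_le_card_mul (c k)
  exact (abs_mul_log_le (abs_nonneg _) (norm_nonneg _) (by positivity) hj).trans
    (Finset.single_le_sum (f := fun j => (1 + (n : ℝ) ^ 2) * |c k j| +
      n * (|c k j| * |Real.log (|c k j|)|)) (fun i _ => by positivity) (Finset.mem_univ j))

lemma summable_inner_rpow {ι E : Type*} [NormedAddCommGroup E] [InnerProductSpace ℝ E] {α : ℝ}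
    (hα : 0 < α) {c : ι → E} (h : Summable fun k => ‖c k‖ ^ α) (u : E) :
    Summable fun k => |(inner ℝ u (c k) : ℝ)| ^ α := by
  refine Summable.of_nonneg_of_le (fun k => by positivity) (fun k => ?_) (h.mul_left (‖u‖ ^ α))
  rw [← Real.mul_rpow (by positivity) (by positivity)]
  exact Real.rpow_le_rpow (by positivity) (abs_real_inner_le_norm _ _) hα.le

lemma summable_inner_mul_log {ι E : Type*} [NormedAddCommGroup E] [InnerProductSpace ℝ E]
    {c : ι → E} (h1 : Summable fun k => ‖c k‖) (h2 : Summable fun k => ‖c k‖ * |Real.log ‖c k‖|)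
    (u : E) :
    Summable fun k => |(inner ℝ u (c k) : ℝ)| * |Real.log (|(inner ℝ u (c k) : ℝ)|)| := by
  refine Summable.of_nonneg_of_le (fun k => by positivity) (fun k => ?_)
    ((h1.mul_left (1 + ‖u‖ ^ 2)).add (h2.mul_left ‖u‖))
  exact abs_mul_log_le (norm_nonneg _) (abs_nonneg _) (norm_nonneg _) (abs_real_inner_le_norm _ _)

/-! ### Atomic measures -/

/-- The measure with mass `w i` at the points `s i`. -/
noncomputable def atomicMeasure {ι E : Type*} [MeasurableSpace E] (w : ι → ℝ) (s : ι → E) :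
    Measure E :=
  Measure.sum fun i => ENNReal.ofReal (w i) • Measure.dirac (s i)

section atomicMeasure

variable {ι E : Type*} [MeasurableSpace E] {w : ι → ℝ} {s : ι → E}

lemma lintegral_atomicMeasure {f : E → ENNReal} (hf : Measurable f) :
    ∫⁻ x, f x ∂(atomicMeasure w s) = ∑' i, ENNReal.ofReal (w i) * f (s i) := by
  rw [atomicMeasure, lintegral_sum_measure]
  refine tsum_congr fun i => ?_
  rw [lintegral_smul_measure, lintegral_dirac' _ hf, smul_eq_mul]

lemma integrable_atomicMeasure (hw : ∀ i, 0 ≤ w i) {f : E → ℂ}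
    (hf : Measurable f) (h : Summable fun i => w i * ‖f (s i)‖) :
    Integrable f (atomicMeasure w s) := by
  refine ⟨hf.aestronglyMeasurable, ?_⟩
  rw [HasFiniteIntegral, lintegral_atomicMeasure hf.enorm]
  refine lt_of_le_of_ne le_top ?_
  have := tsum_ofReal_ne_top (fun i => mul_nonneg (hw i) (norm_nonneg (f (s i)))) h
  simp_rw [ENNReal.ofReal_mul (hw _), ofReal_norm] at this
  exact this

lemma integral_atomicMeasure (hw : ∀ i, 0 ≤ w i) {f : E → ℂ}
    (hf : Measurable f) (h : Summable fun i => w i * ‖f (s i)‖) :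
    ∫ x, f x ∂(atomicMeasure w s) = ∑' i, (w i : ℂ) * f (s i) := by
  have hi := integrable_atomicMeasure hw hf h
  rw [atomicMeasure] at hi ⊢
  rw [← (hasSum_integral_measure hi).tsum_eq]
  refine tsum_congr fun i => ?_
  rw [integral_smul_measure, integral_dirac' _ _ hf.stronglyMeasurable,
    ENNReal.toReal_ofReal (hw i), Complex.real_smul]

lemma map_atomicMeasure {F : Type*} [MeasurableSpace F] {g : E → F} (hg : Measurable g) :
    (atomicMeasure w s).map g = atomicMeasure w fun i => g (s i) := by
  ext A hA
  rw [Measure.map_apply hg hA, atomicMeasure, atomicMeasure, Measure.sum_apply _ hA,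
    Measure.sum_apply _ (hg hA)]
  refine tsum_congr fun i => ?_
  rw [Measure.smul_apply, Measure.smul_apply, Measure.dirac_apply' _ hA,
    Measure.dirac_apply' _ (hg hA)]
  rfl

lemma atomicMeasure_apply_eq_zero {A : Set E} (hA : MeasurableSet A)
    (h : ∀ i, w i = 0 ∨ s i ∉ A) : atomicMeasure w s A = 0 := by
  rw [atomicMeasure, Measure.sum_apply _ hA, ENNReal.tsum_eq_zero]
  intro i
  rw [Measure.smul_apply, Measure.dirac_apply' _ hA]
  rcases h i with h | h
  · simp [h]
  · simp [h]

end atomicMeasure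

/-! ### Seminorms on Euclidean space -/

lemma Seminorm.exists_le_mul_norm {n : ℕ} (p : Seminorm ℝ (EuclideanSpace ℝ (Fin n))) :
    ∃ M, 0 ≤ M ∧ ∀ x, p x ≤ M * ‖x‖ := by
  have hpn : ∀ j, 0 ≤ p (EuclideanSpace.single j 1) := fun j => apply_nonneg p _
  refine ⟨∑ j, p (EuclideanSpace.single j 1), Finset.sum_nonneg fun j _ => hpn j, fun x => ?_⟩
  have hx : x = ∑ j, x j • EuclideanSpace.single j (1 : ℝ) := by
    ext i
    simp [Finset.sum_apply, Pi.single_apply]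
  calc p x = p (∑ j, x j • EuclideanSpace.single j (1 : ℝ)) := by rw [← hx]
    _ ≤ ∑ j, p (x j • EuclideanSpace.single j (1 : ℝ)) :=
        Finset.le_sum_of_subadditive p (map_zero p).le (map_add_le_add p) _ _
    _ ≤ ∑ j, p (EuclideanSpace.single j 1) * ‖x‖ := by
        refine Finset.sum_le_sum fun j _ => ?_
        rw [map_smul_eq_mul, mul_comm]
        exact mul_le_mul_of_nonneg_left (PiLp.norm_apply_le x j) (hpn j)
    _ = _ := by rw [Finset.sum_mul]

lemma Seminorm.continuous_euclideanSpace {n : ℕ} (p : Seminorm ℝ (EuclideanSpace ℝ (Fin n))) :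
    Continuous p := by
  obtain ⟨M, hM, h⟩ := p.exists_le_mul_norm
  refine Seminorm.continuous_of_le (q := M.toNNReal • normSeminorm ℝ _) ?_ fun x => ?_
  · have : ⇑(M.toNNReal • normSeminorm ℝ (EuclideanSpace ℝ (Fin n))) = fun x => M * ‖x‖ := by
      ext x
      simp [NNReal.smul_def, hM]
    rw [this]
    fun_prop
  · simpa [NNReal.smul_def, hM] using h x

lemma measurableSet_unitCylinder {n : ℕ} (p : Seminorm ℝ (EuclideanSpace ℝ (Fin n))) :
    MeasurableSet (unitCylinder p) :=
  (isClosed_eq p.continuous_euclideanSpace continuous_const).measurableSet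

/-! ### Construction of spectral measures on the cylinder -/

section construction

variable {n : ℕ} {p : Seminorm ℝ (EuclideanSpace ℝ (Fin n))} {ι : Type*}
  {c : ι → EuclideanSpace ℝ (Fin n)} {α β : ℝ}

/-- The atomic measure on the unit cylinder with mass `a * p (c i) ^ α` in the direction `c i`. -/
noncomputable def cylinderMeasure (p : Seminorm ℝ (EuclideanSpace ℝ (Fin n))) (α a : ℝ)
    (c : ι → EuclideanSpace ℝ (Fin n)) : Measure (EuclideanSpace ℝ (Fin n)) :=
  atomicMeasure (fun i => a * p (c i) ^ α) fun i => (p (c i))⁻¹ • c i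

lemma cylinderMeasure_compl_unitCylinder (hα : 0 < α) (a : ℝ) :
    cylinderMeasure p α a c (unitCylinder p)ᶜ = 0 := by
  refine atomicMeasure_apply_eq_zero (measurableSet_unitCylinder p).compl fun i => ?_
  -- Where `p (c i) = 0` the normalised point is off the cylinder, but its mass is `0`.
  rcases eq_or_ne (p (c i)) 0 with h | h
  · simp [h, Real.zero_rpow hα.ne']
  · right
    simp only [Set.mem_compl_iff, not_not]
    change p _ = 1
    rw [map_smul_eq_mul, norm_inv, Real.norm_of_nonneg (apply_nonneg p _), inv_mul_cancel₀ h]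

lemma map_neg_cylinderMeasure (a : ℝ) :
    (cylinderMeasure p α a c).map (fun x => -x) = cylinderMeasure p α a fun i => -c i := by
  rw [cylinderMeasure, map_atomicMeasure measurable_neg, cylinderMeasure]
  simp

lemma rpow_mul_stableExponent_inv_mul (hα : 0 < α) {q : ℝ} (hq : 0 ≤ q) (b : ℝ) {x : ℝ}
    (hx : q = 0 → x = 0) :
    ((q ^ α : ℝ) : ℂ) * stableExponent α b (q⁻¹ * x) =
      stableExponent α b x - Complex.I * (b * (2 / Real.pi) * logScale α q * x : ℝ) := by
  rcases hq.eq_or_lt with rfl | hq0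
  · simp [hx rfl, stableExponent_zero hα]
  · have h := stableExponent_mul (α := α) b hq0 (q⁻¹ * x)
    rw [mul_inv_cancel_left₀ hq0.ne'] at h
    rw [h]
    have : b * (2 / Real.pi) * q * logScale α q * (q⁻¹ * x) =
        b * (2 / Real.pi) * logScale α q * x := by field_simp
    rw [this]
    ring

lemma summable_cylinderMeasure_stableExponent (hα : 0 < α) (hc : ∀ i, p (c i) = 0 → c i = 0)
    (hE : ∀ u : EuclideanSpace ℝ (Fin n), Summable fun i => stableExponent α 1 (inner ℝ u (c i)))
    (hl : Summable fun i => |logScale α (p (c i))| * ‖c i‖)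
    {a : ℝ} (ha : 0 ≤ a) (u : EuclideanSpace ℝ (Fin n)) :
    (Summable fun i => (a * p (c i) ^ α) *
      ‖stableExponent α 1 (inner ℝ u ((p (c i))⁻¹ • c i))‖) ∧
    Summable fun i => logScale α (p (c i)) * inner ℝ u (c i) := by
  have h2 : Summable fun i => logScale α (p (c i)) * (inner ℝ u (c i) : ℝ) := by
    refine Summable.of_norm_bounded (hl.mul_left ‖u‖) fun i => ?_
    rw [norm_mul, Real.norm_eq_abs]
    calc _ ≤ |logScale α (p (c i))| * (‖u‖ * ‖c i‖) := by
          gcongr; exact abs_real_inner_le_norm _ _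
      _ = _ := by ring
  refine ⟨?_, h2⟩
  have h3 := (((hE u).sub ((Complex.ofRealCLM.summable
    (h2.mul_left (2 / Real.pi))).mul_left Complex.I)).mul_left (a : ℂ)).norm
  refine h3.congr fun i => ?_
  have := rpow_mul_stableExponent_inv_mul (α := α) hα (apply_nonneg p (c i)) 1
    (x := inner ℝ u (c i)) (fun h => by simp [hc i h])
  have hq : 0 ≤ a * p (c i) ^ α := mul_nonneg ha (Real.rpow_nonneg (apply_nonneg p _) _)
  rw [inner_smul_right, ← Real.norm_of_nonneg hq, ← Complex.norm_real, ← norm_mul, Complex.ofReal_mul,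
    mul_assoc, this]
  simp [mul_assoc]

lemma integral_cylinderMeasure_stableExponent (hα : 0 < α) (hc : ∀ i, p (c i) = 0 → c i = 0)
    (hE : ∀ u : EuclideanSpace ℝ (Fin n), Summable fun i => stableExponent α 1 (inner ℝ u (c i)))
    (hl : Summable fun i => |logScale α (p (c i))| * ‖c i‖)
    {a : ℝ} (ha : 0 ≤ a) (u : EuclideanSpace ℝ (Fin n)) :
    Integrable (fun s => stableExponent α 1 (inner ℝ u s)) (cylinderMeasure p α a c) ∧
    ∫ s, stableExponent α 1 (inner ℝ u s) ∂(cylinderMeasure p α a c) =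
      a * ∑' i, stableExponent α 1 (inner ℝ u (c i)) -
        Complex.I * (a * (2 / Real.pi) * ∑' i, logScale α (p (c i)) * inner ℝ u (c i) : ℝ) := by
  obtain ⟨h1, h2⟩ := summable_cylinderMeasure_stableExponent hα hc hE hl ha u
  have hq : ∀ i, 0 ≤ a * p (c i) ^ α := fun i =>
    mul_nonneg ha (Real.rpow_nonneg (apply_nonneg p _) _)
  have hm : Measurable fun s : EuclideanSpace ℝ (Fin n) => stableExponent α 1 (inner ℝ u s) :=
    (measurable_stableExponent α 1).comp (by fun_prop)
  refine ⟨integrable_atomicMeasure hq hm h1, ?_⟩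
  rw [cylinderMeasure, integral_atomicMeasure hq hm h1]
  have h3 := (((hE u).hasSum.sub ((Complex.hasSum_ofReal.2
    (h2.hasSum.mul_left (2 / Real.pi))).mul_left Complex.I)).mul_left (a : ℂ))
  have h4 : ∀ i, ((a * p (c i) ^ α : ℝ) : ℂ) *
      stableExponent α 1 (inner ℝ u ((p (c i))⁻¹ • c i)) = a * (stableExponent α 1 (inner ℝ u (c i)) -
        Complex.I * ((2 / Real.pi * (logScale α (p (c i)) * inner ℝ u (c i)) : ℝ) : ℂ)) := by
    intro i
    have := rpow_mul_stableExponent_inv_mul (α := α) hα (apply_nonneg p (c i)) 1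
      (x := inner ℝ u (c i)) (fun h => by simp [hc i h])
    rw [inner_smul_right, Complex.ofReal_mul, mul_assoc, this]
    simp [mul_assoc]
  rw [tsum_congr h4, h3.tsum_eq]
  push_cast
  ring

end construction

/-! ### Sufficiency -/

section sufficiency

variable {n : ℕ} {p : Seminorm ℝ (EuclideanSpace ℝ (Fin n))} {ι : Type*}
  {c : ι → EuclideanSpace ℝ (Fin n)} {α β σ : ℝ}
  {law : Measure (EuclideanSpace ℝ (Fin n))}

lemma lintegral_ofReal_lt_top_of_le_norm {E : Type*} [MeasurableSpace E] {Γ : Measure E}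
    {f : E → ℂ} (hf : Integrable f Γ) {g : E → ℝ} {C : ℝ} (h : ∀ s, g s ≤ C * ‖f s‖) :
    ∫⁻ s, ENNReal.ofReal (g s) ∂Γ < ⊤ := by
  have h1 : Integrable (fun s => C * ‖f s‖) Γ := hf.norm.const_mul C
  exact (lintegral_mono fun s => ENNReal.ofReal_le_ofReal (h s)).trans_lt h1.lintegral_lt_top

/-- The scaling corrections at `c i` and `-c i` have opposite signs and leave the factor `(1 + β) /
2 - (1 - β) / 2 = β`. Hypothesis `hl` makes them sum to a vector; it is empty for `α ≠ 1`, where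
`logScale` vanishes. -/
lemma isRepresentableAsymm_of_charFun (hα : 0 < α) (hβ₁ : -1 ≤ β) (hβ₂ : β ≤ 1) (hσ : 0 < σ)
    (hc : ∀ i, p (c i) = 0 → c i = 0)
    (hE : ∀ u : EuclideanSpace ℝ (Fin n), Summable fun i => stableExponent α 1 (inner ℝ u (c i)))
    (hl : Summable fun i => |logScale α (p (c i))| * ‖c i‖)
    (hlaw : ∀ u, charFun law u =
      Complex.exp (-∑' i, ((σ ^ α : ℝ) : ℂ) * stableExponent α β (inner ℝ u (c i)))) :
    IsRepresentableAsymm α p law := by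
  have hc' : ∀ i, p (-c i) = 0 → -c i = 0 := fun i h => by
    rw [hc i (by simpa using h), neg_zero]
  have hE' : ∀ u : EuclideanSpace ℝ (Fin n),
      Summable fun i => stableExponent α 1 (inner ℝ u (-c i)) := fun u =>
    (hE (-u)).congr fun i => by rw [inner_neg_left, inner_neg_right]
  have hl' : Summable fun i => |logScale α (p (-c i))| * ‖-c i‖ := by simpa using hl
  have ha : 0 ≤ σ ^ α * ((1 + β) / 2) := mul_nonneg (by positivity) (by linarith)
  have ha' : 0 ≤ σ ^ α * ((1 - β) / 2) := mul_nonneg (by positivity) (by linarith)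
  set Γ := cylinderMeasure p α (σ ^ α * ((1 + β) / 2)) c +
    cylinderMeasure p α (σ ^ α * ((1 - β) / 2)) fun i => -c i with hΓ
  have hI : ∀ u, Integrable (fun s => stableExponent α 1 (inner ℝ u s)) Γ := fun u =>
    (integral_cylinderMeasure_stableExponent hα hc hE hl ha u).1.add_measure
      (integral_cylinderMeasure_stableExponent hα hc' hE' hl' ha' u).1
  have hls : Summable fun i => logScale α (p (c i)) • c i := by
    refine Summable.of_norm (hl.congr fun i => ?_)
    rw [norm_smul, Real.norm_eq_abs]
  -- The drift cancels the sum of the scaling corrections.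
  refine ⟨Γ, -(σ ^ α * β * (2 / Real.pi)) • ∑' i, logScale α (p (c i)) • c i, ?_, ?_, ?_, ?_⟩
  · rw [hΓ, Measure.add_apply, cylinderMeasure_compl_unitCylinder hα,
      cylinderMeasure_compl_unitCylinder hα, add_zero]
  · exact fun _ u => lintegral_ofReal_lt_top_of_le_norm (C := 1) (hI u) fun s => by
      simpa using rpow_abs_le_norm_stableExponent α 1 _
  · rintro rfl u
    exact lintegral_ofReal_lt_top_of_le_norm (hI u) fun s =>
      abs_mul_abs_log_le_norm_stableExponent _
  · intro u
    rw [hlaw, hΓ, integral_add_measure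
      (integral_cylinderMeasure_stableExponent hα hc hE hl ha u).1
      (integral_cylinderMeasure_stableExponent hα hc' hE' hl' ha' u).1,
      (integral_cylinderMeasure_stableExponent hα hc hE hl ha u).2,
      (integral_cylinderMeasure_stableExponent hα hc' hE' hl' ha' u).2]
    have h1 : ∑' i, ((σ ^ α : ℝ) : ℂ) * stableExponent α β (inner ℝ u (c i)) =
        ((σ ^ α : ℝ) : ℂ) * (((1 + β) / 2 : ℝ) * ∑' i, stableExponent α 1 (inner ℝ u (c i)) +
          ((1 - β) / 2 : ℝ) * ∑' i, stableExponent α 1 (inner ℝ u (-c i))) := by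
      rw [tsum_mul_left, ← tsum_mul_left (a := (((1 + β) / 2 : ℝ) : ℂ)),
        ← tsum_mul_left (a := (((1 - β) / 2 : ℝ) : ℂ)),
        ← ((hE u).mul_left _).tsum_add ((hE' u).mul_left _)]
      congr 1
      refine tsum_congr fun i => ?_
      rw [stableExponent_eq_mixture, inner_neg_right]
    have h2 : inner ℝ u (∑' i, logScale α (p (c i)) • c i) =
        ∑' i, logScale α (p (c i)) * inner ℝ u (c i) := by
      have := (innerSL ℝ u).map_tsum hls
      simpa [inner_smul_right] using this
    have h3 : ∑' i, logScale α (p (-c i)) * inner ℝ u (-c i) =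
        -∑' i, logScale α (p (c i)) * inner ℝ u (c i) := by
      rw [← tsum_neg]
      refine tsum_congr fun i => ?_
      rw [map_neg_eq_map, inner_neg_right, mul_neg]
    rw [h1, h3, inner_smul_right, h2]
    congr 1
    push_cast
    ring

/-- `|·| ^ α` is homogeneous for every `α`, so no logarithmic condition is needed. Half of the mass
goes to each of `± c i`. -/
lemma isRepresentableSymm_of_charFun (hα : 0 < α) (hσ : 0 < σ)
    (hc : ∀ i, p (c i) = 0 → c i = 0)
    (hE : ∀ u : EuclideanSpace ℝ (Fin n), Summable fun i => |(inner ℝ u (c i) : ℝ)| ^ α)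
    (hlaw : ∀ u, charFun law u =
      Complex.exp (-((∑' i, σ ^ α * |(inner ℝ u (c i) : ℝ)| ^ α : ℝ) : ℂ))) :
    IsRepresentableSymm α p law := by
  have ha : 0 ≤ σ ^ α / 2 := by positivity
  have hq : ∀ i, 0 ≤ σ ^ α / 2 * p (c i) ^ α := fun i =>
    mul_nonneg ha (Real.rpow_nonneg (apply_nonneg p _) _)
  have hterm : ∀ u i, σ ^ α / 2 * p (c i) ^ α * |(inner ℝ u ((p (c i))⁻¹ • c i) : ℝ)| ^ α =
      σ ^ α / 2 * |(inner ℝ u (c i) : ℝ)| ^ α := fun u i => by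
    rcases eq_or_ne (p (c i)) 0 with h | h
    · simp [hc i h, Real.zero_rpow hα.ne']
    · have h0 : 0 < p (c i) := (apply_nonneg p _).lt_of_ne' h
      rw [inner_smul_right, abs_mul, abs_of_pos (inv_pos.2 h0),
        Real.mul_rpow (by positivity) (abs_nonneg _), Real.inv_rpow h0.le]
      field_simp
  set Γ₁ := cylinderMeasure p α (σ ^ α / 2) c with hΓ₁
  have hm : ∀ u : EuclideanSpace ℝ (Fin n), Measurable fun s : EuclideanSpace ℝ (Fin n) =>
      ENNReal.ofReal (|(inner ℝ u s : ℝ)| ^ α) := fun u => by fun_prop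
  have hI : ∀ u, ∫⁻ s, ENNReal.ofReal (|(inner ℝ u s : ℝ)| ^ α) ∂Γ₁ =
      ENNReal.ofReal (∑' i, σ ^ α / 2 * |(inner ℝ u (c i) : ℝ)| ^ α) := fun u => by
    rw [hΓ₁, cylinderMeasure, lintegral_atomicMeasure (hm u),
      ENNReal.ofReal_tsum_of_nonneg (fun i => by positivity) ((hE u).mul_left _)]
    refine tsum_congr fun i => ?_
    rw [← ENNReal.ofReal_mul (hq i), hterm]
  have hIneg : ∀ u, ∫⁻ s, ENNReal.ofReal (|(inner ℝ u s : ℝ)| ^ α) ∂(Γ₁.map fun x => -x) =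
      ENNReal.ofReal (∑' i, σ ^ α / 2 * |(inner ℝ u (c i) : ℝ)| ^ α) := fun u => by
    rw [lintegral_map (hm u) measurable_neg, ← hI]
    simp [inner_neg_right]
  have hIsum : ∀ u, ∫⁻ s, ENNReal.ofReal (|(inner ℝ u s : ℝ)| ^ α) ∂(Γ₁ + Γ₁.map fun x => -x) =
      ENNReal.ofReal (∑' i, σ ^ α * |(inner ℝ u (c i) : ℝ)| ^ α) := fun u => by
    rw [lintegral_add_measure, hI, hIneg, ← ENNReal.ofReal_add
      (tsum_nonneg fun i => by positivity) (tsum_nonneg fun i => by positivity), ← two_mul,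
      ← tsum_mul_left]
    congr 1
    refine tsum_congr fun i => by ring
  refine ⟨Γ₁ + Γ₁.map (fun x => -x), ?_, ?_, ?_, ?_⟩
  · rw [Measure.add_apply, hΓ₁, map_neg_cylinderMeasure, cylinderMeasure_compl_unitCylinder hα,
      cylinderMeasure_compl_unitCylinder hα, add_zero]
  · rw [IsSymmetricMeasure, Measure.map_add _ _ measurable_neg,
      Measure.map_map measurable_neg measurable_neg, add_comm]
    congr 1
    have : ((fun x : EuclideanSpace ℝ (Fin n) => -x) ∘ fun x => -x) = id := by ext; simp
    rw [this, Measure.map_id]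
  · intro u
    rw [hIsum]
    exact ENNReal.ofReal_lt_top
  · intro u
    rw [hlaw, integral_eq_lintegral_of_nonneg_ae
      (Filter.Eventually.of_forall fun s => by positivity)
      (Measurable.aestronglyMeasurable (by fun_prop)), hIsum,
      ENNReal.toReal_ofReal (tsum_nonneg fun i => by positivity)]

end sufficiency

/-! ### Symmetric laws -/

section symmetric

lemma charFun_im_eq_zero_of_isSymmetricMeasure {E : Type*} [NormedAddCommGroup E]
    [InnerProductSpace ℝ E] [MeasurableSpace E] [BorelSpace E] {μ : Measure E}
    (h : IsSymmetricMeasure μ) (u : E) : (charFun μ u).im = 0 := by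
  have h1 : charFun μ (-u) = charFun μ u := by
    conv_rhs => rw [← h]
    have := charFun_map_smul (μ := μ) (-1) u
    simpa using this.symm
  rw [charFun_neg] at h1
  exact Complex.conj_eq_iff_im.1 h1

lemma isSymmetricMeasure_of_charFun_neg {E : Type*} [NormedAddCommGroup E]
    [InnerProductSpace ℝ E] [CompleteSpace E] [SecondCountableTopology E] [MeasurableSpace E]
    [BorelSpace E] {μ : Measure E} [IsFiniteMeasure μ] (h : ∀ u, charFun μ (-u) = charFun μ u) :
    IsSymmetricMeasure μ := by
  refine Measure.ext_of_charFun ?_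
  ext u
  have := charFun_map_smul (μ := μ) (-1) u
  simp only [neg_smul, one_smul] at this
  rw [this, h]

/-- The argument of the sine tends to `0` with `t`, so it lies in `(-π, π)` and vanishes for small
`t`. For `α = 1` the values at `δ` and `δ / 2` separate `t` from `t * log t`. -/
lemma eq_zero_of_sin_rpow_add_log_eq_zero {α A B : ℝ} (hα : 0 < α)
    (h : ∀ t, 0 < t → Real.sin (t ^ α * A + t * logScale α t * B) = 0) : A = 0 := by
  have hlog : Filter.Tendsto (fun t : ℝ => t * logScale α t) (𝓝[>] 0) (𝓝 0) := by
    by_cases h1 : α = 1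
    · simp only [logScale, h1, if_true]
      have := (Real.continuous_mul_log.tendsto 0).mono_left (nhdsWithin_le_nhds (s := Set.Ioi 0))
      simpa using this
    · simp [logScale, h1]
  have hpow : Filter.Tendsto (fun t : ℝ => t ^ α) (𝓝[>] 0) (𝓝 0) := by
    have := ((Real.continuous_rpow_const hα.le).tendsto 0).mono_left
      (nhdsWithin_le_nhds (s := Set.Ioi 0))
    rwa [Real.zero_rpow hα.ne'] at this
  have hlim : Filter.Tendsto (fun t : ℝ => t ^ α * A + t * logScale α t * B) (𝓝[>] 0) (𝓝 0) := by
    simpa using (hpow.mul_const A).add (hlog.mul_const B)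
  have hev : ∀ᶠ t in 𝓝[>] (0 : ℝ), t ^ α * A + t * logScale α t * B = 0 := by
    filter_upwards [hlim (Ioo_mem_nhds (neg_lt_zero.2 Real.pi_pos) Real.pi_pos),
      self_mem_nhdsWithin] with t ht ht0
    exact (Real.sin_eq_zero_iff_of_lt_of_lt ht.1 ht.2).1 (h t ht0)
  obtain ⟨δ, hδ, hsub⟩ := mem_nhdsGT_iff_exists_Ioc_subset.1 hev
  have hδ0 : 0 < δ := hδ
  have e1 : δ ^ α * A + δ * logScale α δ * B = 0 := hsub ⟨hδ0, le_refl _⟩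
  have e2 : (δ / 2) ^ α * A + δ / 2 * logScale α (δ / 2) * B = 0 :=
    hsub ⟨by positivity, by linarith⟩
  by_cases h1 : α = 1
  · subst h1
    simp only [logScale, if_true, Real.rpow_one] at e1 e2
    rw [Real.log_div hδ0.ne' two_ne_zero] at e2
    have e3 : δ * Real.log 2 * B = 0 := by linarith
    have hB : B = 0 := by
      have := Real.log_pos one_lt_two
      simpa [hδ0.ne', this.ne'] using e3
    simpa [hB, hδ0.ne'] using e1
  · simp only [logScale, h1, if_false] at e1
    have := Real.rpow_pos_of_pos hδ0 α
    simpa [this.ne'] using e1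

/-- A real characteristic function only fixes the phase modulo `π`. Following the phase along the
ray `t • u` down to `0` shows that it is zero. This covers symmetric paths built from skewed noise.
-/
lemma charFun_eq_exp_of_isSymmetricMeasure {ι E : Type*} [NormedAddCommGroup E]
    [InnerProductSpace ℝ E] [MeasurableSpace E] [BorelSpace E] {law : Measure E} {α β σ : ℝ}
    {c : ι → E} (hα : 0 < α) (hsymm : IsSymmetricMeasure law)
    (hx : ∀ u : E, Summable fun i => |(inner ℝ u (c i) : ℝ)| ^ α)
    (hs : ∀ u : E, Summable fun i => stableExponent α β (inner ℝ u (c i)))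
    (hlaw : ∀ u, charFun law u =
      Complex.exp (-∑' i, ((σ ^ α : ℝ) : ℂ) * stableExponent α β (inner ℝ u (c i)))) (u : E) :
    charFun law u = Complex.exp (-((∑' i, σ ^ α * |(inner ℝ u (c i) : ℝ)| ^ α : ℝ) : ℂ)) := by
  set S : E → ℂ := fun u => ∑' i, ((σ ^ α : ℝ) : ℂ) * stableExponent α β (inner ℝ u (c i)) with hS
  have hre : (S u).re = ∑' i, σ ^ α * |(inner ℝ u (c i) : ℝ)| ^ α := by
    rw [hS, Complex.re_tsum ((hs u).mul_left _)]
    refine tsum_congr fun i => ?_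
    rw [Complex.re_ofReal_mul, stableExponent_re]
  have hlogsum : ∀ t, Summable fun i => logScale α t * (inner ℝ u (c i) : ℝ) := fun t => by
    by_cases h1 : α = 1
    · refine Summable.mul_left _ (Summable.of_abs ?_)
      simpa [h1] using hx u
    · simp [logScale, h1, summable_zero]
  have hscale : ∀ t, 0 < t → (S (t • u)).im = t ^ α * (S u).im + t * logScale α t *
      (σ ^ α * β * (2 / Real.pi) * ∑' i, inner ℝ u (c i)) := by
    intro t ht
    have e : S (t • u) = (t ^ α : ℝ) * S u + Complex.I * ((t * (σ ^ α * β * (2 / Real.pi)) *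
        ∑' i, logScale α t * inner ℝ u (c i) : ℝ) : ℂ) := by
      rw [hS]
      simp only
      have h1 := ((hs u).mul_left ((σ ^ α : ℝ) : ℂ)).hasSum.mul_left ((t ^ α : ℝ) : ℂ)
      have h2 := (Complex.hasSum_ofReal.2
        ((hlogsum t).hasSum.mul_left (t * (σ ^ α * β * (2 / Real.pi))))).mul_left Complex.I
      rw [← (h1.add h2).tsum_eq]
      refine tsum_congr fun i => ?_
      rw [inner_smul_left]
      simp only [conj_trivial]
      rw [stableExponent_mul β ht]
      push_cast
      ring
    rw [e, tsum_mul_left]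
    simp
    ring
  have him : (S u).im = 0 := by
    refine eq_zero_of_sin_rpow_add_log_eq_zero
      (B := σ ^ α * β * (2 / Real.pi) * ∑' i, inner ℝ u (c i)) hα fun t ht => ?_
    rw [← hscale t ht]
    have h1 := charFun_im_eq_zero_of_isSymmetricMeasure hsymm (t • u)
    rw [hlaw, Complex.exp_im] at h1
    have h2 := (mul_eq_zero.1 h1).resolve_left (Real.exp_pos _).ne'
    rw [Complex.neg_im, Real.sin_neg, neg_eq_zero] at h2
    exact h2
  rw [hlaw, ← hre]
  congr 2
  apply Complex.ext
  · simp [hS]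
  · simpa [hS] using him

end symmetric

/-! ### Gaussian measure of slabs -/

section slab

variable {E : Type*} [NormedAddCommGroup E] [InnerProductSpace ℝ E] [FiniteDimensional ℝ E]
  [MeasurableSpace E] [BorelSpace E]

lemma map_inner_stdGaussian (y : E) :
    (stdGaussian E).map (fun v => inner ℝ v y) = gaussianReal 0 (‖y‖₊ ^ 2) := by
  have := Measure.isProbabilityMeasure_map (μ := stdGaussian E)
    (f := fun v : E => (inner ℝ v y : ℝ)) (by fun_prop)
  refine Measure.ext_of_charFun ?_
  ext t
  rw [charFun_apply_real, integral_map (by fun_prop) (by fun_prop), charFun_gaussianReal]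
  have h := charFun_stdGaussian (t • y)
  rw [charFun_apply] at h
  convert h using 1
  · refine integral_congr_ae (Filter.Eventually.of_forall fun v => ?_)
    simp [inner_smul_right]
  · congr 1
    have : (‖t • y‖ : ℂ) ^ 2 = (t : ℂ) ^ 2 * (‖y‖ : ℂ) ^ 2 := by
      rw [norm_smul, ← Complex.ofReal_pow, mul_pow, Real.norm_eq_abs, sq_abs]
      push_cast
      ring
    rw [this]
    simp
    ring

/-- `⟪v, y⟫` is Gaussian with standard deviation `‖y‖`; its density is at most `1 / (2 * ‖y‖)`
because `2 * π ≥ 4`. -/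
lemma stdGaussian_slab_le {y : E} (hy : y ≠ 0) (δ : ℝ) :
    stdGaussian E {v | |(inner ℝ v y : ℝ)| < δ} ≤ ENNReal.ofReal (δ / ‖y‖) := by
  have hy0 : 0 < ‖y‖ := norm_pos_iff.2 hy
  have hs : {v : E | |(inner ℝ v y : ℝ)| < δ} = (fun v => inner ℝ v y) ⁻¹' Set.Ioo (-δ) δ := by
    ext v
    exact abs_lt (a := (inner ℝ v y : ℝ))
  rw [hs, ← Measure.map_apply (by fun_prop) measurableSet_Ioo, map_inner_stdGaussian,
    gaussianReal_apply _ (by simpa using hy)]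
  calc ∫⁻ x in Set.Ioo (-δ) δ, gaussianPDF 0 (‖y‖₊ ^ 2) x
      ≤ ∫⁻ x in Set.Ioo (-δ) δ, ENNReal.ofReal (1 / (2 * ‖y‖)) := by
        refine lintegral_mono fun x => ENNReal.ofReal_le_ofReal ?_
        rw [gaussianPDFReal, one_div]
        have h1 : 2 * ‖y‖ ≤ √(2 * Real.pi * (‖y‖₊ ^ 2 : NNReal)) := by
          apply Real.le_sqrt_of_sq_le
          have := Real.two_le_pi
          push_cast
          nlinarith [sq_nonneg ‖y‖]
        have h2 : Real.exp (-(x - 0) ^ 2 / (2 * (‖y‖₊ ^ 2 : NNReal))) ≤ 1 := by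
          rw [Real.exp_le_one_iff]
          have := sq_nonneg (x - 0)
          exact div_nonpos_of_nonpos_of_nonneg (by linarith) (by positivity)
        calc _ ≤ (√(2 * Real.pi * (‖y‖₊ ^ 2 : NNReal)))⁻¹ * 1 := by gcongr
          _ ≤ _ := by rw [mul_one]; gcongr
    _ = ENNReal.ofReal (1 / (2 * ‖y‖)) * ENNReal.ofReal (2 * δ) := by
        rw [setLIntegral_const, Real.volume_Ioo]
        congr 2
        ring
    _ = _ := by
        rw [← ENNReal.ofReal_mul (by positivity)]
        congr 1
        field_simp

lemma stdGaussian_hyperplane {y : E} (hy : y ≠ 0) :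
    stdGaussian E {v | (inner ℝ v y : ℝ) = 0} = 0 := by
  have : NullSingletonClass (gaussianReal 0 (‖y‖₊ ^ 2)) :=
    nullSingletonClass_gaussianReal (by simpa using hy)
  have hs : {v : E | (inner ℝ v y : ℝ) = 0} = (fun v => inner ℝ v y) ⁻¹' {0} := rfl
  rw [hs, ← Measure.map_apply (by fun_prop) (measurableSet_singleton 0), map_inner_stdGaussian,
    measure_singleton]

end slab

/-! ### Second differences of `|x| ^ α` -/

/-- The symmetric second difference of `|x| ^ α` at `b` with step `a`. -/
noncomputable def secondDiff (α b a : ℝ) : ℝ := |b + a| ^ α + |b - a| ^ α - 2 * |b| ^ α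

lemma secondDiff_zero_left {α : ℝ} (hα : 0 < α) (a : ℝ) : secondDiff α 0 a = 2 * |a| ^ α := by
  simp [secondDiff, Real.zero_rpow hα.ne']
  ring

lemma secondDiff_one (b a : ℝ) : secondDiff 1 b a = 2 * max (|a| - |b|) 0 := by
  simp only [secondDiff, Real.rpow_one]
  rcases abs_cases (b + a) with h1 | h1 <;> rcases abs_cases (b - a) with h2 | h2 <;>
    rcases abs_cases a with h3 | h3 <;> rcases abs_cases b with h4 | h4 <;>
    rcases max_cases (|a| - |b|) 0 with h5 | h5 <;> linarith

/-- Near `1` the second difference is `O(y ^ 2)`; for `α < 1` the cruder `O(|y|)` is enough, and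
holds up to `|y| = 1`. What matters is an exponent strictly above `α`, which is where `α < 2`
enters. All bounds come from Bernoulli inequalities. -/
lemma exists_secondDiff_one_le {α : ℝ} (hα : 0 < α) (hα₂ : α < 2) :
    ∃ q, α < q ∧ ∀ y, |y| ≤ 1 → |secondDiff α 1 y| ≤ 2 * |y| ^ q := by
  rcases lt_or_ge α 1 with h1 | h1
  · refine ⟨1, h1, fun y hy => ?_⟩
    obtain ⟨hy1, hy2⟩ := abs_le.1 hy
    have hl : ∀ z : ℝ, 0 ≤ z → 1 - |1 - z| ≤ z ^ α := fun z hz => by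
      rcases le_or_gt z 1 with h | h
      · have := Real.rpow_le_rpow_of_exponent_ge_of_imp hz h h1.le (fun _ h => absurd h one_ne_zero)
        rw [Real.rpow_one] at this
        rw [abs_of_nonneg (by linarith)]
        linarith
      · have := Real.one_le_rpow h.le hα.le
        linarith [abs_nonneg (1 - z)]
    have e1 := hl (1 + y) (by linarith)
    have e2 := hl (1 - y) (by linarith)
    have e3 := rpow_one_add_le_one_add_mul_self (s := y) hy1 hα.le h1.le
    have e4 := rpow_one_add_le_one_add_mul_self (s := -y) (by linarith) hα.le h1.le
    rw [← sub_eq_add_neg] at e4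
    simp only [sub_add_cancel_left, sub_sub_cancel, abs_neg] at e1 e2
    rw [secondDiff, abs_of_nonneg (by linarith : 0 ≤ 1 + y), abs_of_nonneg (by linarith : 0 ≤ 1 - y),
      abs_one, Real.one_rpow, Real.rpow_one, abs_le]
    have := abs_nonneg y
    constructor <;> linarith
  · refine ⟨2, hα₂, fun y hy => ?_⟩
    obtain ⟨hy1, hy2⟩ := abs_le.1 hy
    -- Factor out `1 + s` and apply the concave Bernoulli inequality to the exponent `α - 1 ∈ [0,
    -- 1]`.
    have hu : ∀ s : ℝ, -1 ≤ s → (1 + s) ^ α ≤ 1 + α * s + (α - 1) * s ^ 2 := fun s hs => by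
      rcases hs.eq_or_lt with rfl | hs'
      · norm_num
        rw [Real.zero_rpow hα.ne']
        linarith
      · have h3 := rpow_one_add_le_one_add_mul_self (s := s) hs (p := α - 1) (by linarith)
          (by linarith)
        have h4 : (1 + s) ^ α = (1 + s) * (1 + s) ^ (α - 1) := by
          have : 0 < 1 + s := by linarith
          rw [Real.rpow_sub_one this.ne']
          field_simp
        rw [h4]
        calc (1 + s) * (1 + s) ^ (α - 1) ≤ (1 + s) * (1 + (α - 1) * s) :=
              mul_le_mul_of_nonneg_left h3 (by linarith)
          _ = _ := by ring
    have e1 := hu y hy1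
    have e2 := hu (-y) (by linarith)
    have e3 := one_add_mul_self_le_rpow_one_add (s := y) hy1 h1
    have e4 := one_add_mul_self_le_rpow_one_add (s := -y) (by linarith) h1
    rw [← sub_eq_add_neg] at e2 e4
    rw [secondDiff, abs_of_nonneg (by linarith : 0 ≤ 1 + y), abs_of_nonneg (by linarith : 0 ≤ 1 - y),
      abs_one, Real.one_rpow, Real.rpow_two, sq_abs, abs_le]
    constructor <;> nlinarith [sq_nonneg y]

lemma secondDiff_eq_mul {α a b : ℝ} (hb : b ≠ 0) :
    secondDiff α b a = |b| ^ α * secondDiff α 1 (a / b) := by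
  have h1 : b + a = b * (1 + a / b) := by field_simp
  have h2 : b - a = b * (1 - a / b) := by field_simp
  rw [secondDiff, h1, h2, abs_mul, abs_mul, Real.mul_rpow (abs_nonneg _) (abs_nonneg _),
    Real.mul_rpow (abs_nonneg _) (abs_nonneg _), secondDiff]
  simp
  ring

/-- Uniformity in `b` is the point: this is the dominating function when the base point is sent to
infinity. -/
lemma abs_secondDiff_le {α : ℝ} (hα : 0 < α) (hα₂ : α < 2) (b a : ℝ) :
    |secondDiff α b a| ≤ 10 * |a| ^ α := by
  have ha : 0 ≤ |a| ^ α := by positivity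
  rcases le_or_gt |a| |b| with h | h
  · rcases eq_or_ne b 0 with rfl | hb
    · rw [secondDiff_zero_left hα, abs_of_nonneg (by positivity)]
      linarith
    obtain ⟨q, hq, hD⟩ := exists_secondDiff_one_le hα hα₂
    have hb0 : 0 < |b| := abs_pos.2 hb
    have hy : |a / b| ≤ 1 := by rw [abs_div, div_le_one hb0]; exact h
    rw [secondDiff_eq_mul hb, abs_mul, abs_of_nonneg (by positivity : 0 ≤ |b| ^ α)]
    have h1 : |a / b| ^ q ≤ |a / b| ^ α :=
      Real.rpow_le_rpow_of_exponent_ge_of_imp (abs_nonneg _) hy hq.le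
        fun _ h => absurd h (hα.trans hq).ne'
    calc |b| ^ α * |secondDiff α 1 (a / b)| ≤ |b| ^ α * (2 * |a / b| ^ α) := by
          gcongr
          exact (hD _ hy).trans (by gcongr)
      _ = 2 * |a| ^ α := by
          rw [mul_left_comm, ← Real.mul_rpow (abs_nonneg _) (abs_nonneg _), ← abs_mul,
            mul_div_cancel₀ _ hb]
      _ ≤ _ := by linarith
  · have h2 : (2 : ℝ) ^ α ≤ 4 := by
      calc (2 : ℝ) ^ α ≤ 2 ^ (2 : ℝ) := Real.rpow_le_rpow_of_exponent_le one_le_two hα₂.le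
        _ = 4 := by norm_num
    have hb : |b| ^ α ≤ |a| ^ α := Real.rpow_le_rpow (abs_nonneg _) h.le hα.le
    have key : ∀ x, |x| ≤ 2 * |a| → |x| ^ α ≤ 4 * |a| ^ α := fun x hx => by
      calc |x| ^ α ≤ (2 * |a|) ^ α := Real.rpow_le_rpow (abs_nonneg _) hx hα.le
        _ = 2 ^ α * |a| ^ α := Real.mul_rpow (by norm_num) (abs_nonneg _)
        _ ≤ _ := by gcongr
    have h3 := key (b + a) (by linarith [abs_add_le b a])
    have h4 := key (b - a) (by linarith [abs_sub b a])
    have h5 : 0 ≤ |b + a| ^ α := by positivity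
    have h6 : 0 ≤ |b - a| ^ α := by positivity
    have h7 : 0 ≤ |b| ^ α := by positivity
    rw [secondDiff, abs_le]
    constructor <;> linarith

lemma tendsto_secondDiff {α : ℝ} (hα : 0 < α) (hα₂ : α < 2) (a : ℝ) {b : ℝ} (hb : b ≠ 0) :
    Filter.Tendsto (fun R : ℕ => secondDiff α (R * b) a) Filter.atTop (𝓝 0) := by
  obtain ⟨q, hq, hD⟩ := exists_secondDiff_one_le hα hα₂
  have hb0 : 0 < |b| := abs_pos.2 hb
  have hlin : Filter.Tendsto (fun R : ℕ => (R : ℝ) * |b|) Filter.atTop Filter.atTop :=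
    tendsto_natCast_atTop_atTop.atTop_mul_const hb0
  have h0 : Filter.Tendsto (fun R : ℕ => 2 * |a| ^ q * ((R : ℝ) * |b|) ^ (-(q - α)))
      Filter.atTop (𝓝 0) := by
    simpa using ((tendsto_rpow_neg_atTop (by linarith : 0 < q - α)).comp hlin).const_mul
      (2 * |a| ^ q)
  refine squeeze_zero_norm' ?_ h0
  filter_upwards [hlin.eventually_ge_atTop |a|, hlin.eventually_gt_atTop 0] with R hR hR0
  have hRb : |(R : ℝ) * b| = R * |b| := by rw [abs_mul, Nat.abs_cast]
  have hne : (R : ℝ) * b ≠ 0 := abs_pos.1 (hRb ▸ hR0)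
  have hy : |a / (R * b)| ≤ 1 := by rw [abs_div, hRb, div_le_one hR0]; exact hR
  rw [Real.norm_eq_abs, secondDiff_eq_mul hne, abs_mul, hRb,
    abs_of_nonneg (Real.rpow_nonneg hR0.le α)]
  calc (R * |b|) ^ α * |secondDiff α 1 (a / (R * b))|
      ≤ (R * |b|) ^ α * (2 * |a / (R * b)| ^ q) := by
        gcongr
        exact hD _ hy
    _ = _ := by
        rw [abs_div, hRb, Real.div_rpow (abs_nonneg _) hR0.le, neg_sub, Real.rpow_sub hR0]
        ring

/-! ### Measures with the same absolute moments of all linear functionals -/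

/-- About `|log₂ A|` terms are bounded by `1`; the remaining ones are dominated by a geometric
series of sum `2`. -/
lemma tsum_min_one_two_pow_le {A : ℝ} (hA : 0 ≤ A) :
    ∑' i : ℕ, ENNReal.ofReal (min 1 ((1 / 2) ^ i * A)) ≤ ENNReal.ofReal (3 + 2 * |Real.log A|) := by
  rcases hA.eq_or_lt with rfl | hA0
  · simp
  set L := |Real.log A| / Real.log 2 with hL
  have hlog2 : 1 / 2 < Real.log 2 := by
    have := Real.log_two_gt_d9
    linarith
  have hL0 : 0 ≤ L := by positivity
  set k := ⌈L⌉₊ with hk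
  have hAk : A ≤ 2 ^ k := by
    have h1 : Real.log A ≤ k * Real.log 2 := by
      have h2 : L ≤ k := Nat.le_ceil L
      rw [hL, div_le_iff₀ (by linarith)] at h2
      exact (le_abs_self _).trans h2
    rw [← Real.log_pow] at h1
    exact (Real.log_le_log_iff hA0 (by positivity)).1 h1
  have h1 : ∑ i ∈ Finset.range k, ENNReal.ofReal (min 1 ((1 / 2) ^ i * A)) ≤ ENNReal.ofReal k := by
    calc _ ≤ ∑ i ∈ Finset.range k, (1 : ENNReal) := by
          refine Finset.sum_le_sum fun i _ => ?_
          rw [← ENNReal.ofReal_one]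
          exact ENNReal.ofReal_le_ofReal (min_le_left _ _)
      _ = _ := by rw [Finset.sum_const, Finset.card_range, nsmul_one, ENNReal.ofReal_natCast]
  have h2 : ∑' i : ℕ, ENNReal.ofReal (min 1 ((1 / 2) ^ (i + k) * A)) ≤ ENNReal.ofReal 2 := by
    have e : ∑' i : ℕ, ENNReal.ofReal ((1 / 2) ^ i) = ENNReal.ofReal 2 := by
      rw [← ENNReal.ofReal_tsum_of_nonneg (fun i => by positivity) summable_geometric_two,
        tsum_geometric_two]
    rw [← e]
    refine ENNReal.tsum_le_tsum fun i => ENNReal.ofReal_le_ofReal ?_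
    refine (min_le_right _ _).trans ?_
    calc (1 / 2 : ℝ) ^ (i + k) * A ≤ (1 / 2) ^ (i + k) * 2 ^ k := by gcongr
      _ = (1 / 2) ^ i := by
        rw [pow_add, mul_assoc, ← mul_pow, one_div, inv_mul_cancel₀ two_ne_zero, one_pow, mul_one]
  have h3 : (k : ℝ) < L + 1 := Nat.ceil_lt_add_one hL0
  have h4 : L ≤ 2 * |Real.log A| := by
    rw [hL, div_le_iff₀ (by linarith)]
    nlinarith [abs_nonneg (Real.log A)]
  have h5 := Summable.sum_add_tsum_nat_add' (k := k) (f := fun i : ℕ =>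
    ENNReal.ofReal (min 1 ((1 / 2) ^ i * A))) ENNReal.summable
  rw [← h5]
  refine (add_le_add h1 h2).trans ?_
  rw [← ENNReal.ofReal_add k.cast_nonneg zero_le_two]
  exact ENNReal.ofReal_le_ofReal (by linarith)

section moments

variable {E : Type*} [NormedAddCommGroup E] [InnerProductSpace ℝ E] [MeasurableSpace E] {α : ℝ}
  {Γ N : Measure E}

lemma integrable_secondDiff (hΓ : ∀ u : E, Integrable (fun s => |(inner ℝ u s : ℝ)| ^ α) Γ)
    (v w : E) : Integrable (fun s => secondDiff α (inner ℝ v s) (inner ℝ w s)) Γ := by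
  have h := ((hΓ (v + w)).add (hΓ (v - w))).sub ((hΓ v).const_mul 2)
  simp only [secondDiff, ← inner_add_left, ← inner_sub_left]
  exact h

lemma integral_secondDiff (hΓ : ∀ u : E, Integrable (fun s => |(inner ℝ u s : ℝ)| ^ α) Γ)
    (v w : E) : ∫ s, secondDiff α (inner ℝ v s) (inner ℝ w s) ∂Γ =
      ∫ s, |(inner ℝ (v + w) s : ℝ)| ^ α ∂Γ + ∫ s, |(inner ℝ (v - w) s : ℝ)| ^ α ∂Γ -
        2 * ∫ s, |(inner ℝ v s : ℝ)| ^ α ∂Γ := by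
  rw [← integral_const_mul, ← integral_add (hΓ _) (hΓ _), ← integral_sub]
  · simp only [secondDiff, ← inner_add_left, ← inner_sub_left]
  · exact (hΓ _).add (hΓ _)
  · exact (hΓ v).const_mul 2

/-- The measure with density `|⟪w, ·⟫| ^ α`. -/
noncomputable def weightedMeasure (Γ : Measure E) (α : ℝ) (w : E) : Measure E :=
  Γ.withDensity fun s => ENNReal.ofReal (|(inner ℝ w s : ℝ)| ^ α)

lemma isFiniteMeasure_weightedMeasure {w : E}
    (hΓ : Integrable (fun s => |(inner ℝ w s : ℝ)| ^ α) Γ) :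
    IsFiniteMeasure (weightedMeasure Γ α w) :=
  isFiniteMeasure_withDensity hΓ.lintegral_lt_top.ne

lemma lintegral_pos_part_eq_of_moments_eq
    (hΓ : ∀ u : E, Integrable (fun s => |(inner ℝ u s : ℝ)|) Γ)
    (hN : ∀ u : E, Integrable (fun s => |(inner ℝ u s : ℝ)|) N)
    (hEq : ∀ u : E, ∫ s, |(inner ℝ u s : ℝ)| ∂Γ = ∫ s, |(inner ℝ u s : ℝ)| ∂N) (v w : E) :
    ∫⁻ s, ENNReal.ofReal (|(inner ℝ w s : ℝ)| - |(inner ℝ v s : ℝ)|) ∂Γ =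
      ∫⁻ s, ENNReal.ofReal (|(inner ℝ w s : ℝ)| - |(inner ℝ v s : ℝ)|) ∂N := by
  have key : ∀ {M : Measure E}, (∀ u : E, Integrable (fun s => |(inner ℝ u s : ℝ)|) M) →
      ∫⁻ s, ENNReal.ofReal (|(inner ℝ w s : ℝ)| - |(inner ℝ v s : ℝ)|) ∂M =
        ENNReal.ofReal (1 / 2 * (∫ s, |(inner ℝ (v + w) s : ℝ)| ∂M +
          ∫ s, |(inner ℝ (v - w) s : ℝ)| ∂M - 2 * ∫ s, |(inner ℝ v s : ℝ)| ∂M)) := by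
    intro M hM
    have hM' : ∀ u : E, Integrable (fun s => |(inner ℝ u s : ℝ)| ^ (1 : ℝ)) M := by simpa using hM
    have h1 := (integrable_secondDiff hM' v w).const_mul (1 / 2)
    have h2 := integral_secondDiff hM' v w
    simp only [Real.rpow_one] at h2
    rw [← h2, ← integral_const_mul, ofReal_integral_eq_lintegral_ofReal h1]
    · refine lintegral_congr fun s => ?_
      rw [secondDiff_one, ← mul_assoc]
      norm_num [ENNReal.ofReal_max]
    · refine Filter.Eventually.of_forall fun s => ?_
      simp only [secondDiff_one, Pi.zero_apply]
      positivity
  rw [key hΓ, key hN, hEq, hEq, hEq]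

end moments

section comparison

variable {E : Type*} [NormedAddCommGroup E] [InnerProductSpace ℝ E] [FiniteDimensional ℝ E]
  [MeasurableSpace E] [BorelSpace E] {α : ℝ} {Γ N : Measure E}

lemma ae_weightedMeasure_iff {w : E} {P : E → Prop} (hα : 0 < α) :
    (∀ᵐ s ∂(weightedMeasure Γ α w), P s) ↔ ∀ᵐ s ∂Γ, (inner ℝ w s : ℝ) ≠ 0 → P s := by
  rw [weightedMeasure, ae_withDensity_iff (by fun_prop)]
  refine Filter.eventually_congr (Filter.Eventually.of_forall fun s => ?_)
  have : ENNReal.ofReal (|(inner ℝ w s : ℝ)| ^ α) ≠ 0 ↔ (inner ℝ w s : ℝ) ≠ 0 := by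
    rw [Ne, ENNReal.ofReal_eq_zero, not_le]
    constructor
    · intro h h0
      simp [h0, Real.zero_rpow hα.ne'] at h
    · intro h
      have := abs_pos.2 h
      positivity
  rw [this]

/-- For fixed `s` with `T s ≠ 0`, a hyperplane is Gaussian-null; Fubini exchanges the quantifiers.
`Γ` need not be σ-finite, so it is first weighted by `|⟪w, ·⟫| ^ α`, which makes it finite and only
loses points with `⟪w, s⟫ = 0`. -/
lemma ae_stdGaussian_inner_ne_zero (hα : 0 < α) {w : E}
    (hΓ : Integrable (fun s => |(inner ℝ w s : ℝ)| ^ α) Γ) (T : E →L[ℝ] E)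
    (hT : ∀ᵐ s ∂Γ, T s ≠ 0) :
    ∀ᵐ v ∂(stdGaussian E), ∀ᵐ s ∂Γ, (inner ℝ w s : ℝ) ≠ 0 → (inner ℝ v (T s) : ℝ) ≠ 0 := by
  have := isFiniteMeasure_weightedMeasure hΓ
  have hm : MeasurableSet {q : E × E | (inner ℝ q.1 (T q.2) : ℝ) = 0} :=
    measurableSet_eq_fun (by fun_prop) measurable_const
  have h0 : ((stdGaussian E).prod (weightedMeasure Γ α w))
      {q : E × E | (inner ℝ q.1 (T q.2) : ℝ) = 0} = 0 := by
    rw [Measure.prod_apply_symm hm, lintegral_eq_zero_iff (measurable_measure_prodMk_right hm)]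
    have hT' : ∀ᵐ s ∂(weightedMeasure Γ α w), T s ≠ 0 := by
      rw [ae_weightedMeasure_iff hα]
      filter_upwards [hT] with s hs _ using hs
    filter_upwards [hT'] with s hs
    exact stdGaussian_hyperplane hs
  filter_upwards [Measure.measure_ae_null_of_prod_null h0] with v hv
  rw [← ae_weightedMeasure_iff hα, ae_iff]
  simpa using hv

lemma ae_inner_eq_zero_of_moments_eq (hα : 0 < α) (hα₂ : α < 2)
    (hΓ : ∀ u : E, Integrable (fun s => |(inner ℝ u s : ℝ)| ^ α) Γ)
    (hN : ∀ u : E, Integrable (fun s => |(inner ℝ u s : ℝ)| ^ α) N)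
    (hEq : ∀ u : E, ∫ s, |(inner ℝ u s : ℝ)| ^ α ∂Γ = ∫ s, |(inner ℝ u s : ℝ)| ^ α ∂N)
    (T : E →L[ℝ] E) (hT : ∀ᵐ s ∂Γ, T s ≠ 0) (w : E) :
    ∀ᵐ x ∂N, T x = 0 → (inner ℝ w x : ℝ) = 0 := by
  obtain ⟨v, hv⟩ := (ae_stdGaussian_inner_ne_zero hα (hΓ w) T hT).exists
  have hlim : ∀ {M : Measure E}, (∀ u : E, Integrable (fun s => |(inner ℝ u s : ℝ)| ^ α) M) →
      Filter.Tendsto (fun R : ℕ => ∫ s, secondDiff α (R * inner ℝ v (T s)) (inner ℝ w s) ∂M)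
        Filter.atTop (𝓝 (∫ s, if (inner ℝ v (T s) : ℝ) = 0 then 2 * |(inner ℝ w s : ℝ)| ^ α else 0
          ∂M)) := by
    intro M hM
    refine tendsto_integral_of_dominated_convergence
      (fun s => 10 * |(inner ℝ w s : ℝ)| ^ α) (fun R => ?_) ((hM w).const_mul 10) (fun R => ?_) ?_
    · refine Measurable.aestronglyMeasurable ?_
      unfold secondDiff
      fun_prop
    · exact Filter.Eventually.of_forall fun s => abs_secondDiff_le hα hα₂ _ _
    · refine Filter.Eventually.of_forall fun s => ?_
      split_ifs with h
      · simp only [h, mul_zero, secondDiff_zero_left hα]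
        exact tendsto_const_nhds
      · exact tendsto_secondDiff hα hα₂ _ h
  have hsame : ∀ R : ℕ, ∫ s, secondDiff α (R * inner ℝ v (T s)) (inner ℝ w s) ∂Γ =
      ∫ s, secondDiff α (R * inner ℝ v (T s)) (inner ℝ w s) ∂N := by
    intro R
    -- Moving `T` to `v` by the adjoint turns this into a second difference of the common moment
    -- function.
    have e : ∀ s, (R : ℝ) * (inner ℝ v (T s) : ℝ) =
        inner ℝ ((R : ℝ) • ContinuousLinearMap.adjoint T v) s := fun s => by
      rw [inner_smul_left, ContinuousLinearMap.adjoint_inner_left]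
      simp
    simp_rw [e]
    rw [integral_secondDiff hΓ, integral_secondDiff hN, hEq, hEq, hEq]
  have h1 := hlim hΓ
  simp_rw [hsame] at h1
  have h2 := tendsto_nhds_unique h1 (hlim hN)
  have hz : ∫ s, (if (inner ℝ v (T s) : ℝ) = 0 then 2 * |(inner ℝ w s : ℝ)| ^ α else 0) ∂Γ = 0 := by
    refine integral_eq_zero_of_ae ?_
    filter_upwards [hv] with s hs
    split_ifs with h
    · have : (inner ℝ w s : ℝ) = 0 := by
        by_contra hw
        exact hs hw h
      simp [this, Real.zero_rpow hα.ne']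
    · rfl
  rw [hz, eq_comm, integral_eq_zero_iff_of_nonneg] at h2
  · filter_upwards [h2] with x hx hTx
    simp only [hTx, inner_zero_right, if_true, Pi.zero_apply] at hx
    by_contra hw
    have := abs_pos.2 hw
    have : 0 < 2 * |(inner ℝ w x : ℝ)| ^ α := by positivity
    exact this.ne' hx
  · intro s
    simp only [Pi.zero_apply]
    split_ifs
    · positivity
    · exact le_refl _
  · refine Integrable.mono' ((hN w).const_mul 2) ?_ (Filter.Eventually.of_forall fun s => ?_)
    · refine Measurable.aestronglyMeasurable (Measurable.ite ?_ (by fun_prop) measurable_const)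
      exact measurableSet_eq_fun (by fun_prop) measurable_const
    · split_ifs
      · rw [Real.norm_of_nonneg (by positivity)]
      · rw [norm_zero]; positivity

/-- The `i`-th integrand is at most `|⟪w, s⟫|` and vanishes unless `v` lies in a slab of Gaussian
measure at most `min 1 (2⁻ⁱ * |⟪w, s⟫| / δ)`. Summing over `i` gives a logarithm, so the average
over `v` is bounded by the logarithmic moment, and some `v` has a finite sum. -/
lemma exists_tsum_lintegral_pos_part_lt_top
    (hΓ : ∀ u : E, Integrable (fun s => |(inner ℝ u s : ℝ)|) Γ) {w : E}
    (hlog : ∫⁻ s, ENNReal.ofReal (|(inner ℝ w s : ℝ)| * |Real.log (|(inner ℝ w s : ℝ)|)|) ∂Γ < ⊤)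
    (T : E →L[ℝ] E) {δ : ℝ} (hδ : 0 < δ) (hT : ∀ᵐ s ∂Γ, δ ≤ ‖T s‖) :
    ∃ v : E, ∑' i : ℕ, ∫⁻ s, ENNReal.ofReal
      (|(inner ℝ w s : ℝ)| - 2 ^ i * |(inner ℝ v (T s) : ℝ)|) ∂Γ < ⊤ := by
  have hΓ1 : ∀ u : E, Integrable (fun s => |(inner ℝ u s : ℝ)| ^ (1 : ℝ)) Γ := by simpa using hΓ
  have := isFiniteMeasure_weightedMeasure (hΓ1 w)
  set W := weightedMeasure Γ 1 w with hW
  set A : ℕ → Set (E × E) := fun i =>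
    {q : E × E | 2 ^ i * |(inner ℝ q.1 (T q.2) : ℝ)| < |(inner ℝ w q.2 : ℝ)|} with hA
  have hAm : ∀ i, MeasurableSet (A i) := fun i => measurableSet_lt (by fun_prop) (by fun_prop)
  have hWl : ∀ f : E → ENNReal, Measurable f → ∫⁻ s, f s ∂W =
      ∫⁻ s, ENNReal.ofReal (|(inner ℝ w s : ℝ)|) * f s ∂Γ := fun f hf => by
    rw [hW, weightedMeasure, lintegral_withDensity_eq_lintegral_mul _ (by fun_prop) hf]
    simp
  have hslab : ∀ᵐ s ∂W, ∑' i, stdGaussian E ((fun v => (v, s)) ⁻¹' A i) ≤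
      ENNReal.ofReal (3 + 2 * |Real.log (δ⁻¹ * |(inner ℝ w s : ℝ)|)|) := by
    rw [hW, ae_weightedMeasure_iff one_pos]
    filter_upwards [hT] with s hs _
    refine le_trans (ENNReal.tsum_le_tsum fun i => ?_)
      (tsum_min_one_two_pow_le (A := δ⁻¹ * |(inner ℝ w s : ℝ)|) (by positivity))
    rw [ENNReal.ofReal_min, le_min_iff, ENNReal.ofReal_one]
    refine ⟨prob_le_one, ?_⟩
    have hTs : T s ≠ 0 := norm_pos_iff.1 (hδ.trans_le hs)
    have e : (fun v => (v, s)) ⁻¹' A i =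
        {v : E | |(inner ℝ v (T s) : ℝ)| < (1 / 2) ^ i * |(inner ℝ w s : ℝ)|} := by
      ext v
      change 2 ^ i * |(inner ℝ v (T s) : ℝ)| < |(inner ℝ w s : ℝ)| ↔
        |(inner ℝ v (T s) : ℝ)| < (1 / 2) ^ i * |(inner ℝ w s : ℝ)|
      rw [one_div, inv_pow, ← div_eq_inv_mul, lt_div_iff₀' (by positivity)]
    rw [e]
    refine (stdGaussian_slab_le hTs _).trans (ENNReal.ofReal_le_ofReal ?_)
    rw [mul_left_comm, ← div_eq_inv_mul]
    gcongr
  have hfin : ∫⁻ v, ∑' i, W (Prod.mk v ⁻¹' A i) ∂(stdGaussian E) < ⊤ := by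
    rw [lintegral_tsum fun i => (measurable_measure_prodMk_left (hAm i)).aemeasurable]
    have e : ∀ i, ∫⁻ v, W (Prod.mk v ⁻¹' A i) ∂(stdGaussian E) =
        ∫⁻ s, stdGaussian E ((fun v => (v, s)) ⁻¹' A i) ∂W := fun i => by
      rw [← Measure.prod_apply (hAm i), Measure.prod_apply_symm (hAm i)]
    simp_rw [e]
    rw [← lintegral_tsum fun i => (measurable_measure_prodMk_right (hAm i)).aemeasurable]
    refine (lintegral_mono_ae hslab).trans_lt ?_
    rw [hWl _ (by fun_prop)]
    set C := 3 + 2 * |Real.log δ⁻¹| with hC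
    have hint : Integrable (fun s : E => C * |(inner ℝ w s : ℝ)|) Γ := (hΓ w).const_mul C
    calc ∫⁻ s, ENNReal.ofReal (|(inner ℝ w s : ℝ)|) *
          ENNReal.ofReal (3 + 2 * |Real.log (δ⁻¹ * |(inner ℝ w s : ℝ)|)|) ∂Γ
        ≤ ∫⁻ s, (ENNReal.ofReal (C * |(inner ℝ w s : ℝ)|) + 2 *
            ENNReal.ofReal (|(inner ℝ w s : ℝ)| * |Real.log (|(inner ℝ w s : ℝ)|)|)) ∂Γ := by
          refine lintegral_mono fun s => ?_
          rw [← ENNReal.ofReal_mul (abs_nonneg _), ← ENNReal.ofReal_ofNat 2,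
            ← ENNReal.ofReal_mul (by norm_num), ← ENNReal.ofReal_add (by positivity) (by positivity)]
          apply ENNReal.ofReal_le_ofReal
          rcases eq_or_ne (inner ℝ w s : ℝ) 0 with h0 | h0
          · simp [h0]
          · rw [Real.log_mul (inv_ne_zero hδ.ne') (abs_ne_zero.2 h0)]
            have h3 := abs_add_le (Real.log δ⁻¹) (Real.log |(inner ℝ w s : ℝ)|)
            have h4 := mul_le_mul_of_nonneg_left h3 (abs_nonneg (inner ℝ w s : ℝ))
            rw [hC]
            nlinarith
      _ < ⊤ := by
          rw [lintegral_add_left (by fun_prop), lintegral_const_mul _ (by fun_prop)]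
          exact ENNReal.add_lt_top.2
            ⟨hint.lintegral_lt_top, ENNReal.mul_lt_top ENNReal.ofNat_lt_top hlog⟩
  obtain ⟨v, hv⟩ := (ae_lt_top' (AEMeasurable.tsum fun i =>
    (measurable_measure_prodMk_left (hAm i)).aemeasurable) hfin.ne).exists
  refine ⟨v, lt_of_le_of_lt (ENNReal.tsum_le_tsum fun i => ?_) hv⟩
  have hm : MeasurableSet (Prod.mk v ⁻¹' A i) := measurable_prodMk_left (hAm i)
  rw [← lintegral_indicator_one hm, hWl _ (measurable_one.indicator hm)]
  refine lintegral_mono fun s => ?_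
  by_cases hs : s ∈ Prod.mk v ⁻¹' A i
  · rw [Set.indicator_of_mem hs, Pi.one_apply, mul_one]
    apply ENNReal.ofReal_le_ofReal
    have : 0 ≤ 2 ^ i * |(inner ℝ v (T s) : ℝ)| := by positivity
    linarith
  · have h1 : |(inner ℝ w s : ℝ)| ≤ 2 ^ i * |(inner ℝ v (T s) : ℝ)| := not_lt.1 hs
    rw [ENNReal.ofReal_of_nonpos (by linarith)]
    exact zero_le

end comparison

/-! ### Consequences of representability -/

section necessity

variable {n : ℕ} {p : Seminorm ℝ (EuclideanSpace ℝ (Fin n))}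
  {c : ℤ → EuclideanSpace ℝ (Fin n)} {α β σ : ℝ}
  {law : Measure (EuclideanSpace ℝ (Fin n))}

/-- `|x| * |log |x||` vanishes at `|x| = 1`, but the logarithms at `x` and `2 * x` differ by `log 2
> 1 / 2` and cannot both be small. Thus logarithmic moments of all functionals give first moments.
-/
lemma abs_le_two_mul_abs_mul_log (x : ℝ) :
    |x| ≤ 2 * (|x| * |Real.log (|x|)| + |2 * x| * |Real.log (|2 * x|)|) := by
  rcases eq_or_ne x 0 with rfl | hx
  · simp
  have hx0 := abs_pos.2 hx
  have hl : Real.log |2 * x| = Real.log 2 + Real.log |x| := by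
    rw [abs_mul, abs_two, Real.log_mul two_ne_zero hx0.ne']
  have hlog2 : 1 / 2 < Real.log 2 := by
    have := Real.log_two_gt_d9
    linarith
  rw [hl, abs_mul, abs_two]
  have h1 : 1 / 2 ≤ |Real.log (|x|)| + |Real.log 2 + Real.log (|x|)| := by
    have := le_abs_self (Real.log 2 + Real.log |x|)
    have := neg_le_abs (Real.log |x|)
    linarith
  have h2 := abs_nonneg (Real.log 2 + Real.log |x|)
  nlinarith [mul_nonneg hx0.le h2]

lemma integrable_of_lintegral_ofReal_lt_top {E : Type*} [MeasurableSpace E] {Γ : Measure E}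
    {f : E → ℝ} (hf : Measurable f) (h0 : ∀ s, 0 ≤ f s) (h : ∫⁻ s, ENNReal.ofReal (f s) ∂Γ < ⊤) :
    Integrable f Γ :=
  ⟨hf.aestronglyMeasurable,
    (hasFiniteIntegral_iff_ofReal (Filter.Eventually.of_forall h0)).2 h⟩

lemma integrable_abs_of_lintegral_log {E : Type*} [NormedAddCommGroup E] [InnerProductSpace ℝ E]
    [MeasurableSpace E] [BorelSpace E] [SecondCountableTopology E] {Γ : Measure E}
    (h : ∀ u : E, ∫⁻ s, ENNReal.ofReal (|(inner ℝ u s : ℝ)| * |Real.log (|(inner ℝ u s : ℝ)|)|) ∂Γ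
      < ⊤) (u : E) : Integrable (fun s => |(inner ℝ u s : ℝ)|) Γ := by
  have hi : ∀ u : E, Integrable
      (fun s => |(inner ℝ u s : ℝ)| * |Real.log (|(inner ℝ u s : ℝ)|)|) Γ := fun u =>
    integrable_of_lintegral_ofReal_lt_top (by fun_prop) (fun s => by positivity) (h u)
  refine Integrable.mono' (((hi u).add (hi ((2 : ℝ) • u))).const_mul 2)
    (Measurable.aestronglyMeasurable (by fun_prop)) (Filter.Eventually.of_forall fun s => ?_)
  have := abs_le_two_mul_abs_mul_log (inner ℝ u s)
  simpa [inner_smul_left] using this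

/-- The modulus of the characteristic function forgets drift and skewness and leaves the real part
of the exponent. -/
lemma IsRepresentableAsymm.exists_moments (hα : 0 < α)
    (hx : ∀ u : EuclideanSpace ℝ (Fin n), Summable fun i => stableExponent α β (inner ℝ u (c i)))
    (hlaw : ∀ u, charFun law u =
      Complex.exp (-∑' i, ((σ ^ α : ℝ) : ℂ) * stableExponent α β (inner ℝ u (c i))))
    (hrep : IsRepresentableAsymm α p law) :
    ∃ Γ : Measure (EuclideanSpace ℝ (Fin n)), Γ (unitCylinder p)ᶜ = 0 ∧
      (∀ u, Integrable (fun s => |(inner ℝ u s : ℝ)| ^ α) Γ) ∧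
      (α = 1 → ∀ u, ∫⁻ s, ENNReal.ofReal (|inner ℝ u s| * |Real.log (|inner ℝ u s|)|) ∂Γ < ⊤) ∧
      ∀ u, ∫ s, |(inner ℝ u s : ℝ)| ^ α ∂Γ = ∑' i, σ ^ α * |(inner ℝ u (c i) : ℝ)| ^ α := by
  obtain ⟨Γ, μ₀, hΓC, h1, h2, hΓ⟩ := hrep
  have hm : ∀ u : EuclideanSpace ℝ (Fin n),
      Measurable fun s : EuclideanSpace ℝ (Fin n) => stableExponent α 1 (inner ℝ u s) := fun u =>
    (measurable_stableExponent α 1).comp (by fun_prop)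
  have hI : ∀ u, Integrable (fun s => |(inner ℝ u s : ℝ)| ^ α) Γ := fun u => by
    by_cases hα1 : α = 1
    · subst hα1
      simpa using integrable_abs_of_lintegral_log (h2 rfl) u
    · exact integrable_of_lintegral_ofReal_lt_top (by fun_prop) (fun s => by positivity) (h1 hα1 u)
  have hE : ∀ u, Integrable (fun s => stableExponent α 1 (inner ℝ u s)) Γ := fun u => by
    have hw : Integrable (fun s => |(inner ℝ u s : ℝ)| ^ α * |stableW α (inner ℝ u s)|) Γ := by
      by_cases hα1 : α = 1
      · simp_rw [rpow_mul_abs_stableW_eq hα1]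
        exact (integrable_of_lintegral_ofReal_lt_top (by fun_prop) (fun s => by positivity)
          (h2 hα1 u)).const_mul _
      · simp only [stableW, hα1, if_false]
        exact (hI u).mul_const _
    refine Integrable.mono' ((hI u).add hw) (hm u).aestronglyMeasurable
      (Filter.Eventually.of_forall fun s => ?_)
    simpa using norm_stableExponent_le α 1 (inner ℝ u s)
  refine ⟨Γ, hΓC, hI, h2, fun u => ?_⟩
  have h3 := congrArg norm ((hΓ u).symm.trans (hlaw u))
  rw [Complex.norm_exp, Complex.norm_exp, Real.exp_eq_exp, Complex.add_re, Complex.neg_re,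
    Complex.neg_re, Complex.re_tsum ((hx u).mul_left _)] at h3
  have h4 : (∫ s, stableExponent α 1 (inner ℝ u s) ∂Γ).re = ∫ s, |(inner ℝ u s : ℝ)| ^ α ∂Γ := by
    rw [← Complex.reCLM_apply, ← Complex.reCLM.integral_comp_comm (hE u)]
    simp only [Complex.reCLM_apply, stableExponent_re]
  rw [h4] at h3
  simp only [Complex.re_ofReal_mul, stableExponent_re] at h3
  simp at h3
  exact h3

lemma IsRepresentableSymm.exists_moments
    (hx : ∀ u : EuclideanSpace ℝ (Fin n), Summable fun i => stableExponent α β (inner ℝ u (c i)))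
    (hlaw : ∀ u, charFun law u =
      Complex.exp (-∑' i, ((σ ^ α : ℝ) : ℂ) * stableExponent α β (inner ℝ u (c i))))
    (hrep : IsRepresentableSymm α p law) :
    ∃ Γ : Measure (EuclideanSpace ℝ (Fin n)), Γ (unitCylinder p)ᶜ = 0 ∧
      (∀ u, Integrable (fun s => |(inner ℝ u s : ℝ)| ^ α) Γ) ∧
      ∀ u, ∫ s, |(inner ℝ u s : ℝ)| ^ α ∂Γ = ∑' i, σ ^ α * |(inner ℝ u (c i) : ℝ)| ^ α := by
  obtain ⟨Γ, hΓC, -, h1, hΓ⟩ := hrep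
  refine ⟨Γ, hΓC, fun u => integrable_of_lintegral_ofReal_lt_top (by fun_prop)
    (fun s => by positivity) (h1 u), fun u => ?_⟩
  have h3 := congrArg norm ((hΓ u).symm.trans (hlaw u))
  rw [Complex.norm_exp, Complex.norm_exp, Real.exp_eq_exp, Complex.neg_re,
    Complex.neg_re, Complex.re_tsum ((hx u).mul_left _), Complex.ofReal_re] at h3
  simp only [Complex.re_ofReal_mul, stableExponent_re] at h3
  linarith

lemma atomicMeasure_const_moments (hσ : 0 ≤ σ)
    (hx : ∀ u : EuclideanSpace ℝ (Fin n), Summable fun i => |(inner ℝ u (c i) : ℝ)| ^ α)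
    (u : EuclideanSpace ℝ (Fin n)) :
    Integrable (fun s => |(inner ℝ u s : ℝ)| ^ α) (atomicMeasure (fun _ : ℤ => σ ^ α) c) ∧
      ∫ s, |(inner ℝ u s : ℝ)| ^ α ∂(atomicMeasure (fun _ : ℤ => σ ^ α) c) =
        ∑' i, σ ^ α * |(inner ℝ u (c i) : ℝ)| ^ α := by
  have h1 : ∫⁻ s, ENNReal.ofReal (|(inner ℝ u s : ℝ)| ^ α) ∂(atomicMeasure (fun _ : ℤ => σ ^ α) c) =
      ENNReal.ofReal (∑' i, σ ^ α * |(inner ℝ u (c i) : ℝ)| ^ α) := by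
    rw [lintegral_atomicMeasure (by fun_prop),
      ENNReal.ofReal_tsum_of_nonneg (fun i => by positivity) ((hx u).mul_left _)]
    refine tsum_congr fun i => ?_
    rw [ENNReal.ofReal_mul (by positivity)]
  refine ⟨integrable_of_lintegral_ofReal_lt_top (by fun_prop) (fun s => by positivity)
    (h1 ▸ ENNReal.ofReal_lt_top), ?_⟩
  rw [integral_eq_lintegral_of_nonneg_ae (Filter.Eventually.of_forall fun s => by positivity)
    (Measurable.aestronglyMeasurable (by fun_prop)), h1,
    ENNReal.toReal_ofReal (tsum_nonneg fun i => by positivity)]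

lemma of_ae_atomicMeasure {ι E : Type*} [Countable ι] [MeasurableSpace E]
    [MeasurableSingletonClass E] {w : ι → ℝ} {s : ι → E} {P : E → Prop}
    (h : ∀ᵐ x ∂(atomicMeasure w s), P x) {i : ι} (hw : 0 < w i) : P (s i) := by
  have h1 := (Measure.ae_sum_iff.1 h) i
  rw [Measure.ae_ennreal_smul_measure_iff (by simpa using hw), ae_dirac_eq] at h1
  exact h1

lemma eq_zero_of_moments_eq (hα : 0 < α) (hα₂ : α < 2) (hσ : 0 < σ)
    (T : EuclideanSpace ℝ (Fin n) →L[ℝ] EuclideanSpace ℝ (Fin n)) (hT : ∀ x, p x = 0 ↔ T x = 0)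
    (hx : ∀ u : EuclideanSpace ℝ (Fin n), Summable fun i => |(inner ℝ u (c i) : ℝ)| ^ α)
    {Γ : Measure (EuclideanSpace ℝ (Fin n))} (hΓC : Γ (unitCylinder p)ᶜ = 0)
    (hΓ : ∀ u, Integrable (fun s => |(inner ℝ u s : ℝ)| ^ α) Γ)
    (hEq : ∀ u, ∫ s, |(inner ℝ u s : ℝ)| ^ α ∂Γ = ∑' i, σ ^ α * |(inner ℝ u (c i) : ℝ)| ^ α)
    (i : ℤ) (hi : p (c i) = 0) : c i = 0 := by
  have hN := atomicMeasure_const_moments hσ.le hx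
  have hTΓ : ∀ᵐ s ∂Γ, T s ≠ 0 := by
    have : ∀ᵐ s ∂Γ, s ∈ unitCylinder p := by
      rw [ae_iff]
      exact hΓC
    filter_upwards [this] with s hs h0
    rw [← hT] at h0
    exact one_ne_zero ((show p s = 1 from hs).symm.trans h0)
  -- The functional tested is `c i` itself, so that its value at the atom `c i` is `‖c i‖ ^ 2`.
  have h1 := ae_inner_eq_zero_of_moments_eq hα hα₂ hΓ (fun u => (hN u).1)
    (fun u => (hEq u).trans (hN u).2.symm) T hTΓ (c i)
  have h2 := of_ae_atomicMeasure h1 (i := i) (by positivity) ((hT _).1 hi)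
  exact inner_self_eq_zero.1 h2

/-- With `k = ⌊log₂ (A / B)⌋`, each `i < k` has `2 ^ i * B ≤ A / 2` and contributes at least `A /
2`. The `-A` on the left pays for the rounding of `k`. -/
lemma ofReal_mul_log_sub_le {A B : ℝ} (hA : 0 ≤ A) (hB : 0 < B) :
    ENNReal.ofReal (A * Real.log (A / B) - A) ≤ 2 * ∑' i : ℕ, ENNReal.ofReal (A - 2 ^ i * B) := by
  rcases le_or_gt A B with h | h
  · have h1 : Real.log (A / B) ≤ 0 :=
      Real.log_nonpos (by positivity) ((div_le_one hB).2 h)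
    rw [ENNReal.ofReal_of_nonpos (by nlinarith)]
    exact zero_le
  have hA0 : 0 < A := hB.trans h
  have hl0 : 0 < Real.log (A / B) := Real.log_pos ((one_lt_div hB).2 h)
  have hlog2 : 0 < Real.log 2 := Real.log_pos one_lt_two
  have hlog2' : Real.log 2 ≤ 1 := by
    have := Real.log_two_lt_d9
    linarith
  set L := Real.log (A / B) / Real.log 2 with hL
  have hL0 : 0 ≤ L := by positivity
  have hLl : Real.log (A / B) ≤ L := by
    rw [hL, le_div_iff₀ hlog2]
    nlinarith
  set k := ⌊L⌋₊ with hk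
  have hkL : (k : ℝ) ≤ L := Nat.floor_le hL0
  have hLk : L < k + 1 := Nat.lt_floor_add_one L
  have hpow : (2 : ℝ) ^ k * B ≤ A := by
    rw [← le_div_iff₀ hB, ← Real.log_le_log_iff (by positivity) (by positivity), Real.log_pow]
    rwa [hL, le_div_iff₀ hlog2] at hkL
  have hterm : ∀ i ∈ Finset.range k, ENNReal.ofReal (A / 2) ≤ ENNReal.ofReal (A - 2 ^ i * B) := by
    intro i hi
    apply ENNReal.ofReal_le_ofReal
    have h1 : (2 : ℝ) ^ (i + 1) ≤ 2 ^ k :=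
      pow_le_pow_right₀ one_le_two (Finset.mem_range.1 hi)
    have h2 : (2 : ℝ) ^ (i + 1) * B ≤ 2 ^ k * B := by gcongr
    rw [pow_succ] at h2
    linarith
  calc ENNReal.ofReal (A * Real.log (A / B) - A) ≤ ENNReal.ofReal (2 * (k * (A / 2))) := by
        apply ENNReal.ofReal_le_ofReal
        nlinarith
    _ = 2 * ∑ i ∈ Finset.range k, ENNReal.ofReal (A / 2) := by
        rw [ENNReal.ofReal_mul zero_le_two, ENNReal.ofReal_mul k.cast_nonneg, Finset.sum_const,
          Finset.card_range, nsmul_eq_mul, ENNReal.ofReal_natCast, ENNReal.ofReal_ofNat]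
    _ ≤ 2 * ∑ i ∈ Finset.range k, ENNReal.ofReal (A - 2 ^ i * B) := by
        gcongr 2 * ?_
        exact Finset.sum_le_sum hterm
    _ ≤ _ := by
        gcongr
        exact ENNReal.sum_le_tsum _

lemma exists_summable_bound_mul_log (hσ : 0 < σ)
    (T : EuclideanSpace ℝ (Fin n) →L[ℝ] EuclideanSpace ℝ (Fin n))
    {δ M : ℝ} (hδ : 0 < δ) (hM : 0 ≤ M) (hTδ : ∀ x, p x = 1 → δ ≤ ‖T x‖)
    (hTM : ∀ x, ‖T x‖ ≤ M * p x) (hc : Summable fun i => ‖c i‖)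
    {Γ : Measure (EuclideanSpace ℝ (Fin n))} (hΓC : Γ (unitCylinder p)ᶜ = 0)
    (hΓ : ∀ u, Integrable (fun s => |(inner ℝ u s : ℝ)|) Γ)
    (hlog : ∀ u, ∫⁻ s, ENNReal.ofReal (|inner ℝ u s| * |Real.log (|inner ℝ u s|)|) ∂Γ < ⊤)
    (hEq : ∀ u, ∫ s, |(inner ℝ u s : ℝ)| ∂Γ = ∑' i, σ * |(inner ℝ u (c i) : ℝ)|)
    (w : EuclideanSpace ℝ (Fin n)) :
    ∃ g : ℤ → ℝ, (∀ i, 0 ≤ g i) ∧ Summable g ∧ ∀ i, 0 < p (c i) →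
      |(inner ℝ w (c i) : ℝ)| * Real.log (|(inner ℝ w (c i) : ℝ)| / p (c i)) ≤ g i := by
  have hx : ∀ u : EuclideanSpace ℝ (Fin n), Summable fun i => |(inner ℝ u (c i) : ℝ)| ^ (1 : ℝ) :=
    summable_inner_rpow one_pos (by simpa using hc)
  have hN := atomicMeasure_const_moments hσ.le hx
  simp only [Real.rpow_one] at hN
  set N := atomicMeasure (fun _ : ℤ => σ) c with hNdef
  have hTΓ : ∀ᵐ s ∂Γ, δ ≤ ‖T s‖ := by
    have : ∀ᵐ s ∂Γ, s ∈ unitCylinder p := by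
      rw [ae_iff]
      exact hΓC
    filter_upwards [this] with s hs
    exact hTδ s hs
  obtain ⟨v, hv⟩ := exists_tsum_lintegral_pos_part_lt_top hΓ (hlog w) T hδ hTΓ
  have hsame : ∀ i : ℕ, ∫⁻ s, ENNReal.ofReal
      (|(inner ℝ w s : ℝ)| - 2 ^ i * |(inner ℝ v (T s) : ℝ)|) ∂Γ =
      ∑' k, ENNReal.ofReal σ * ENNReal.ofReal
        (|(inner ℝ w (c k) : ℝ)| - 2 ^ i * |(inner ℝ v (T (c k)) : ℝ)|) := by
    intro i
    have e : ∀ s, (2 : ℝ) ^ i * |(inner ℝ v (T s) : ℝ)| =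
        |(inner ℝ ((2 : ℝ) ^ i • ContinuousLinearMap.adjoint T v) s : ℝ)| := fun s => by
      rw [inner_smul_left, ContinuousLinearMap.adjoint_inner_left, abs_mul]
      simp
    simp_rw [e]
    rw [lintegral_pos_part_eq_of_moments_eq hΓ (fun u => (hN u).1)
      (fun u => (hEq u).trans (hN u).2.symm), hNdef, lintegral_atomicMeasure (by fun_prop)]
  simp_rw [hsame] at hv
  rw [ENNReal.tsum_comm] at hv
  simp_rw [ENNReal.tsum_mul_left] at hv
  set G : ℤ → ENNReal := fun k => ∑' i : ℕ, ENNReal.ofReal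
    (|(inner ℝ w (c k) : ℝ)| - 2 ^ i * |(inner ℝ v (T (c k)) : ℝ)|) with hG
  have hGfin : ∑' k, G k ≠ ⊤ := by
    intro h
    rw [h, ENNReal.mul_top (by simpa using hσ)] at hv
    exact lt_irrefl _ hv
  -- `q * p (c k)` bounds `|⟪v, T (c k)⟫|`; the `+ 1` keeps it positive, as the logarithm requires.
  set q := ‖v‖ * M + 1 with hq
  have hq0 : 0 < q := by positivity
  refine ⟨fun k => 2 * (G k).toReal + ‖w‖ * (1 + |Real.log q|) * ‖c k‖, fun k => by positivity,
    ((ENNReal.summable_toReal hGfin).mul_left 2).add (hc.mul_left _), fun k hk => ?_⟩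
  set A := |(inner ℝ w (c k) : ℝ)| with hA
  have hAc : A ≤ ‖w‖ * ‖c k‖ := abs_real_inner_le_norm _ _
  have hA0 : 0 ≤ A := abs_nonneg _
  have hB : |(inner ℝ v (T (c k)) : ℝ)| ≤ q * p (c k) := by
    refine (abs_real_inner_le_norm _ _).trans ?_
    have h1 := mul_le_mul_of_nonneg_left (hTM (c k)) (norm_nonneg v)
    rw [hq]
    nlinarith
  have h1 : ENNReal.ofReal (A * Real.log (A / (q * p (c k))) - A) ≤ 2 * G k := by
    refine (ofReal_mul_log_sub_le hA0 (by positivity)).trans ?_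
    gcongr
    refine ENNReal.tsum_le_tsum fun i => ENNReal.ofReal_le_ofReal ?_
    gcongr
  have hGk : G k ≠ ⊤ := ENNReal.ne_top_of_tsum_ne_top hGfin k
  have h2 : A * Real.log (A / (q * p (c k))) - A ≤ 2 * (G k).toReal := by
    have := (ENNReal.ofReal_le_iff_le_toReal (ENNReal.mul_ne_top (by simp) hGk)).1 h1
    simpa using this
  rcases hA0.eq_or_lt with h0 | h0
  · rw [← h0, zero_mul]
    positivity
  have h3 : Real.log (A / (q * p (c k))) = Real.log (A / p (c k)) - Real.log q := by
    rw [mul_comm q, ← div_div, Real.log_div (by positivity) hq0.ne']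
  rw [h3] at h2
  have h4 := mul_le_mul_of_nonneg_left (le_abs_self (Real.log q)) hA0
  have h5 := mul_le_mul_of_nonneg_right hAc (by positivity : 0 ≤ 1 + |Real.log q|)
  nlinarith

/-- The coordinate functionals suffice: the largest coordinate of `c i` is at least `‖c i‖ / n`.
Only large `‖c i‖ / p (c i)` is delicate, since `p ≤ M' * ‖·‖` bounds this ratio below. -/
lemma summable_norm_mul_log_div [NeZero n] (hσ : 0 < σ)
    (T : EuclideanSpace ℝ (Fin n) →L[ℝ] EuclideanSpace ℝ (Fin n))
    {δ M : ℝ} (hδ : 0 < δ) (hM : 0 ≤ M) (hTδ : ∀ x, p x = 1 → δ ≤ ‖T x‖)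
    (hTM : ∀ x, ‖T x‖ ≤ M * p x) (hc : Summable fun i => ‖c i‖)
    (hpc : ∀ i, p (c i) = 0 → c i = 0)
    {Γ : Measure (EuclideanSpace ℝ (Fin n))} (hΓC : Γ (unitCylinder p)ᶜ = 0)
    (hΓ : ∀ u, Integrable (fun s => |(inner ℝ u s : ℝ)|) Γ)
    (hlog : ∀ u, ∫⁻ s, ENNReal.ofReal (|inner ℝ u s| * |Real.log (|inner ℝ u s|)|) ∂Γ < ⊤)
    (hEq : ∀ u, ∫ s, |(inner ℝ u s : ℝ)| ∂Γ = ∑' i, σ * |(inner ℝ u (c i) : ℝ)|) :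
    Summable fun i => ‖c i‖ * |Real.log (p (c i) / ‖c i‖)| := by
  obtain ⟨M', hM', hpM'⟩ := p.exists_le_mul_norm
  choose g hg0 hgs hg using fun j : Fin n => exists_summable_bound_mul_log hσ T hδ hM hTδ hTM hc hΓC hΓ
    hlog hEq (EuclideanSpace.single j 1)
  refine Summable.of_nonneg_of_le (fun i => by positivity) (fun i => ?_)
    ((hc.mul_left (Real.log n + 2 * |Real.log M'|)).add
      ((summable_sum fun j (_ : j ∈ Finset.univ) => hgs j).mul_left (n : ℝ)))
  rcases eq_or_ne (c i) 0 with h0 | h0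
  · rw [h0, norm_zero, zero_mul, mul_zero, zero_add]
    have : 0 ≤ ∑ j, g j i := Finset.sum_nonneg fun j _ => hg0 j i
    positivity
  have hn0 : 0 < ‖c i‖ := norm_pos_iff.2 h0
  have hp0 : 0 < p (c i) := (apply_nonneg p _).lt_of_ne' fun h => h0 (hpc i h)
  obtain ⟨j, hj⟩ := exists_norm_le_card_mul (c i)
  have hin : (inner ℝ (EuclideanSpace.single j (1 : ℝ)) (c i) : ℝ) = c i j := by
    simp [EuclideanSpace.inner_single_left]
  have hgj := hg j i hp0
  rw [hin] at hgj
  have hnpos : (0 : ℝ) < n := Nat.cast_pos.2 (NeZero.pos n)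
  have hn1 : (1 : ℝ) ≤ n := by exact_mod_cast NeZero.one_le
  have hA0 : 0 < |c i j| := by
    by_contra! h
    nlinarith
  have hM'0 : 0 < M' := by
    by_contra! h
    nlinarith [hpM' (c i)]
  have h1 : -|Real.log M'| ≤ Real.log (‖c i‖ / p (c i)) := by
    have h2 : M'⁻¹ ≤ ‖c i‖ / p (c i) := by
      rw [le_div_iff₀ hp0, inv_mul_le_iff₀ hM'0]
      exact hpM' _
    have h3 := Real.log_le_log (by positivity) h2
    rw [Real.log_inv] at h3
    linarith [le_abs_self (Real.log M')]
  have h2 : Real.log (‖c i‖ / p (c i)) ≤ Real.log n + Real.log (|c i j| / p (c i)) := by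
    rw [← Real.log_mul hnpos.ne' (by positivity), ← mul_div_assoc]
    exact Real.log_le_log (by positivity) (by gcongr)
  have h3 : |Real.log (p (c i) / ‖c i‖)| = |Real.log (‖c i‖ / p (c i))| := by
    rw [← inv_div, Real.log_inv, abs_neg]
  have h4 : |Real.log (‖c i‖ / p (c i))| ≤
      Real.log n + Real.log (|c i j| / p (c i)) + 2 * |Real.log M'| := by
    have := abs_nonneg (Real.log M')
    rw [abs_le]
    constructor <;> linarith
  have h5 : ‖c i‖ * Real.log (|c i j| / p (c i)) ≤ n * g j i := by
    rcases le_or_gt (Real.log (|c i j| / p (c i))) 0 with h | h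
    · have := mul_nonneg hnpos.le (hg0 j i)
      nlinarith
    · calc ‖c i‖ * Real.log (|c i j| / p (c i)) ≤ n * |c i j| * Real.log (|c i j| / p (c i)) := by
            gcongr
        _ = n * (|c i j| * Real.log (|c i j| / p (c i))) := by ring
        _ ≤ _ := by gcongr
  have h6 : g j i ≤ ∑ j, g j i :=
    Finset.single_le_sum (f := fun j => g j i) (fun j _ => hg0 j i) (Finset.mem_univ j)
  have h7 := mul_le_mul_of_nonneg_left h6 hnpos.le
  rw [h3]
  have h8 := mul_le_mul_of_nonneg_left h4 hn0.le
  nlinarith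

end necessity

/-! ### The projection on the observed coordinates -/

section headProj

/-- The projection of `ℝⁿ` on its coordinates with index at most `m`. -/
noncomputable def headProj (n m : ℕ) :
    EuclideanSpace ℝ (Fin n) →L[ℝ] EuclideanSpace ℝ (Fin n) :=
  LinearMap.toContinuousLinearMap
    { toFun := fun x => WithLp.toLp 2 fun j => if (j : ℕ) ≤ m then x j else 0
      map_add' := fun x y => by
        ext j
        by_cases h : (j : ℕ) ≤ m <;> simp [h]
      map_smul' := fun a x => by
        ext j
        by_cases h : (j : ℕ) ≤ m <;> simp [h] }

variable {n m : ℕ}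

lemma headProj_apply (x : EuclideanSpace ℝ (Fin n)) (j : Fin n) :
    headProj n m x j = if (j : ℕ) ≤ m then x j else 0 := rfl

lemma headProj_eq_zero_iff (x : EuclideanSpace ℝ (Fin n)) :
    headProj n m x = 0 ↔ ∀ j : Fin n, (j : ℕ) ≤ m → x j = 0 := by
  constructor
  · intro h j hj
    have := congrArg (fun y : EuclideanSpace ℝ (Fin n) => y j) h
    simpa [headProj_apply, hj] using this
  · intro h
    ext j
    rw [headProj_apply]
    split_ifs with hj
    · simpa using h j hj
    · rfl

lemma headProj_headProj (x : EuclideanSpace ℝ (Fin n)) :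
    headProj n m (headProj n m x) = headProj n m x := by
  ext j
  by_cases h : (j : ℕ) ≤ m <;> simp [headProj_apply, h]

end headProj

section projection

variable {n : ℕ} {p : Seminorm ℝ (EuclideanSpace ℝ (Fin n))}
  {T : EuclideanSpace ℝ (Fin n) →L[ℝ] EuclideanSpace ℝ (Fin n)}

lemma Seminorm.apply_eq_apply_proj (hT : ∀ x, p x = 0 ↔ T x = 0) (hTT : ∀ x, T (T x) = T x)
    (x : EuclideanSpace ℝ (Fin n)) : p (T x) = p x := by
  have h1 : p (T x - x) = 0 := (hT _).2 (by rw [map_sub, hTT, sub_self])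
  have h2 := map_sub_le_add p (T x) (T x - x)
  have h3 := map_add_le_add p (T x - x) x
  rw [sub_sub_cancel] at h2
  rw [sub_add_cancel] at h3
  linarith

lemma Seminorm.exists_le_norm_proj (hT : ∀ x, p x = 0 ↔ T x = 0) (hTT : ∀ x, T (T x) = T x) :
    ∃ δ, 0 < δ ∧ ∀ x, p x = 1 → δ ≤ ‖T x‖ := by
  obtain ⟨M, hM, h⟩ := p.exists_le_mul_norm
  refine ⟨1 / (M + 1), by positivity, fun x hx => ?_⟩
  have h1 := h (T x)
  rw [Seminorm.apply_eq_apply_proj hT hTT, hx] at h1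
  rw [div_le_iff₀ (by positivity)]
  nlinarith [norm_nonneg (T x)]

/-- On the range of `T` the seminorm is a norm, so it has a positive minimum on the unit sphere of
that subspace, unless the range is zero. -/
lemma Seminorm.exists_norm_proj_le (hT : ∀ x, p x = 0 ↔ T x = 0) (hTT : ∀ x, T (T x) = T x) :
    ∃ M, 0 ≤ M ∧ ∀ x, ‖T x‖ ≤ M * p x := by
  set K : Set (EuclideanSpace ℝ (Fin n)) := Metric.sphere 0 1 ∩ {x | T x = x} with hK
  have hKc : IsCompact K :=
    (isCompact_sphere 0 1).inter_right (isClosed_eq T.continuous continuous_id)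
  have hmem : ∀ x, T x ≠ 0 → ‖T x‖⁻¹ • T x ∈ K := fun x hx => by
    refine ⟨?_, ?_⟩
    · rw [mem_sphere_zero_iff_norm, norm_smul, norm_inv, norm_norm,
        inv_mul_cancel₀ (norm_ne_zero_iff.2 hx)]
    · change T _ = _
      rw [map_smul, hTT]
  rcases K.eq_empty_or_nonempty with h0 | h0
  · refine ⟨0, le_refl _, fun x => ?_⟩
    by_contra! h
    have hx : T x ≠ 0 := fun h1 => by simp [h1] at h
    have := hmem x hx
    rw [h0] at this
    exact this
  · obtain ⟨y, hy, hmin⟩ := hKc.exists_isMinOn h0 p.continuous_euclideanSpace.continuousOn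
    have hpy : 0 < p y := by
      refine (apply_nonneg p y).lt_of_ne' fun h => ?_
      have h1 := (hT y).1 h
      have h2 : T y = y := hy.2
      have h3 := mem_sphere_zero_iff_norm.1 hy.1
      rw [← h2, h1, norm_zero] at h3
      exact zero_ne_one h3
    refine ⟨(p y)⁻¹, by positivity, fun x => ?_⟩
    rcases eq_or_ne (T x) 0 with hx | hx
    · rw [hx, norm_zero]
      have := apply_nonneg p x
      positivity
    · have h1 : p y ≤ p (‖T x‖⁻¹ • T x) := hmin (hmem x hx)
      have h2 : 0 < ‖T x‖ := norm_pos_iff.2 hx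
      rw [map_smul_eq_mul, norm_inv, norm_norm, Seminorm.apply_eq_apply_proj hT hTT,
        ← div_eq_inv_mul, le_div_iff₀ h2] at h1
      rwa [← div_eq_inv_mul, le_div_iff₀ hpy, mul_comm]

end projection

/-! ### The gap condition -/

/-- A vanishing `c k` only reaches back to `d (k - h)`. Since `h ≥ 1` it gives at least `d (k - 1) =
0`, so the window of zeros can be shifted left by one and the argument repeated. -/
lemma noInteriorGap_iff {d : ℤ → ℝ} {m h : ℕ} (hh : 1 ≤ h)
    {p : Seminorm ℝ (EuclideanSpace ℝ (Fin (m + h + 1)))}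
    (hp : ∀ x, p x = 0 ↔ ∀ j : Fin (m + h + 1), (j : ℕ) ≤ m → x j = 0) :
    NoInteriorGap d m ↔ ∀ k, p (coeffVector d m h k) = 0 → coeffVector d m h k = 0 := by
  have hp' : ∀ k, p (coeffVector d m h k) = 0 ↔ ∀ i : ℤ, k ≤ i → i ≤ k + (m : ℤ) → d i = 0 := by
    intro k
    rw [hp]
    constructor
    · intro H i hi1 hi2
      have := H ⟨(k + m - i).toNat, by omega⟩ (by simp; omega)
      simp only [coeffVector] at this
      rwa [Int.toNat_of_nonneg (by omega), sub_sub_cancel] at this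
    · intro H j hj
      exact H _ (by omega) (by omega)
  constructor
  · intro H k hk
    have h1 := (hp' k).1 hk
    have h2 := H k h1
    ext j
    change d (k + m - (j : ℕ)) = 0
    by_cases hj : (j : ℕ) ≤ m
    · exact h1 _ (by omega) (by omega)
    · exact h2 _ (by omega)
  · intro H k hk
    have key : ∀ N : ℕ, ∀ i : ℤ, k - N ≤ i → i ≤ k + m → d i = 0 := by
      intro N
      induction N with
      | zero => simpa using hk
      | succ N ih =>
        intro i hi1 hi2
        rcases eq_or_ne i (k - N - 1) with rfl | hne
        · have h1 := H (k - N) ((hp' _).2 fun i hi1 hi2 => ih i hi1 (by omega))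
          have h2 := congrArg (fun y : EuclideanSpace ℝ (Fin (m + h + 1)) =>
            y ⟨m + 1, by omega⟩) h1
          simp only [coeffVector] at h2
          -- The coordinate of index `m + 1` is the first unobserved one and holds the coefficient
          -- just left of the window.
          have e : k - N + (m : ℤ) - ((m + 1 : ℕ) : ℤ) = k - N - 1 := by push_cast; ring
          rw [e] at h2
          simpa using h2
        · exact ih i (by push_cast at hi1; omega) hi2
    intro l hl
    exact key (k - l).toNat l (by omega) (by omega)

/-! ### Summability of the coefficient vectors -/

lemma IsMACoeff.summable_rpow_alpha {α β : ℝ} {d : ℤ → ℝ} (hd : IsMACoeff α β d) :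
    Summable fun k => |d k| ^ α := by
  by_cases hc : α ≠ 1 ∨ β = 0
  · obtain ⟨s, hs, hsα, -, hsum⟩ := hd.summable_rpow hc
    exact summable_abs_rpow_of_le hs hsα.le hsum
  · push Not at hc
    obtain ⟨rfl, hβ⟩ := hc
    simpa using (hd.summable_log rfl hβ).1

lemma IsMACoeff.summable_norm_coeffVector {α β : ℝ} {d : ℤ → ℝ} (hd : IsMACoeff α β d)
    (hα : 0 < α) (m h : ℕ) : Summable fun k => ‖coeffVector d m h k‖ ^ α := by
  refine summable_norm_rpow_of_coord hα fun j => ?_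
  have := hd.summable_rpow_alpha
  rw [← (Equiv.addRight ((m : ℤ) - (j : ℕ))).summable_iff] at this
  refine this.congr fun k => ?_
  simp [coeffVector, add_sub_assoc]

lemma IsMACoeff.summable_norm_coeffVector_mul_log {β : ℝ} {d : ℤ → ℝ} (hd : IsMACoeff 1 β d)
    (hβ : β ≠ 0) (m h : ℕ) :
    Summable fun k => ‖coeffVector d m h k‖ * |Real.log ‖coeffVector d m h k‖| := by
  obtain ⟨h1, h2⟩ := hd.summable_log rfl hβ
  refine summable_norm_mul_log_of_coord (fun j => ?_) fun j => ?_
  · rw [← (Equiv.addRight ((m : ℤ) - (j : ℕ))).summable_iff] at h1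
    refine h1.congr fun k => ?_
    simp [coeffVector, add_sub_assoc]
  · rw [← (Equiv.addRight ((m : ℤ) - (j : ℕ))).summable_iff] at h2
    refine h2.congr fun k => ?_
    simp [coeffVector, add_sub_assoc]

lemma summable_log_seminorm_mul_norm {n : ℕ} {p : Seminorm ℝ (EuclideanSpace ℝ (Fin n))}
    {c : ℤ → EuclideanSpace ℝ (Fin n)} (hpc : ∀ i, p (c i) = 0 → c i = 0)
    (h1 : Summable fun k => ‖c k‖ * |Real.log ‖c k‖|)
    (h2 : Summable fun k => ‖c k‖ * |Real.log (p (c k) / ‖c k‖)|) :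
    Summable fun k => |Real.log (p (c k))| * ‖c k‖ := by
  refine Summable.of_nonneg_of_le (fun k => by positivity) (fun k => ?_) (h1.add h2)
  rcases eq_or_ne (c k) 0 with h0 | h0
  · simp [h0]
  · have hp0 : p (c k) ≠ 0 := fun h => h0 (hpc k h)
    rw [Real.log_div hp0 (norm_ne_zero_iff.2 h0), ← mul_add, mul_comm]
    gcongr
    have := abs_add_le (Real.log (p (c k)) - Real.log ‖c k‖) (Real.log ‖c k‖)
    rw [sub_add_cancel] at this
    linarith

theorem lemma1 {Ω : Type*} [MeasurableSpace Ω] (P : Measure Ω) [IsProbabilityMeasure P]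
    (α β σ : ℝ) (hα₀ : 0 < α) (hα₂ : α < 2) (hβ₁ : -1 ≤ β) (hβ₂ : β ≤ 1) (hσ : 0 < σ)
    (ε : ℤ → Ω → ℝ) (hε : IsStableNoise P α β σ ε)
    (d : ℤ → ℝ) (hd : IsMACoeff α β d)
    (m h : ℕ) (hh : 1 ≤ h) (t : ℤ)
    (p : Seminorm ℝ (EuclideanSpace ℝ (Fin (m + h + 1))))
    (hp : ∀ x, p x = 0 ↔ ∀ j : Fin (m + h + 1), (j : ℕ) ≤ m → x j = 0) :
    ((α ≠ 1 ∨ β = 0 ∨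
        IsSymmetricMeasure (P.map (pathVector (movingAverage d ε) m h t))) →
      (IsRepresentable α p (P.map (pathVector (movingAverage d ε) m h t)) ↔
        NoInteriorGap d m)) ∧
    (α = 1 → β ≠ 0 →
      ¬ IsSymmetricMeasure (P.map (pathVector (movingAverage d ε) m h t)) →
      (IsRepresentable α p (P.map (pathVector (movingAverage d ε) m h t)) ↔
        NoInteriorGap d m ∧
        Summable fun k : ℤ => ‖coeffVector d m h k‖ *
          |Real.log (p (coeffVector d m h k) / ‖coeffVector d m h k‖)|)) := by
  set law := P.map (pathVector (movingAverage d ε) m h t) with hlawdef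
  set c := coeffVector d m h with hcdef
  have hsum := ae_hasSum_pathVector hα₀ hσ hε hd m h t
  have hVm := aemeasurable_of_ae_hasSum
    (fun i => (hε.measurable (i + t)).smul_const (coeffVector d m h i)) hsum
  have : IsProbabilityMeasure law := Measure.isProbabilityMeasure_map hVm
  have hcα : Summable fun k => ‖c k‖ ^ α := hd.summable_norm_coeffVector hα₀ m h
  have hx : ∀ u, Summable fun i => |(inner ℝ u (c i) : ℝ)| ^ α := summable_inner_rpow hα₀ hcα
  have hlogx : α = 1 → β ≠ 0 → ∀ u, Summable fun i =>
      |(inner ℝ u (c i) : ℝ)| * |Real.log (|(inner ℝ u (c i) : ℝ)|)| := by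
    rintro rfl hβ
    exact summable_inner_mul_log (by simpa using hcα) (hd.summable_norm_coeffVector_mul_log hβ m h)
  have hs : ∀ u, Summable fun i => stableExponent α β (inner ℝ u (c i)) := fun u =>
    summable_stableExponent (hx u) fun h1 h2 => hlogx h1 h2 u
  -- For `α = 1` the totally skewed exponent needs logarithmic sums, which are assumed only when `β
  -- ≠ 0`. In the excluded case the law is symmetric and this is not needed.
  have hE : (α ≠ 1 ∨ β ≠ 0) → ∀ u, Summable fun i => stableExponent α 1 (inner ℝ u (c i)) :=
    fun hc u => summable_stableExponent (hx u) fun h1 _ =>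
      hlogx h1 (hc.resolve_left (not_not.2 h1)) u
  have hlaw : ∀ u, charFun law u =
      Complex.exp (-∑' i, ((σ ^ α : ℝ) : ℂ) * stableExponent α β (inner ℝ u (c i))) := fun u =>
    charFun_map_of_ae_hasSum (fun i => hε.measurable (i + t))
      (hε.indep.precomp (add_left_injective t)) hsum (fun i => hε.law _ _) ((hs u).mul_left _)
  have hT : ∀ x, p x = 0 ↔ headProj (m + h + 1) m x = 0 := fun x => by
    rw [hp, headProj_eq_zero_iff]
  have hgap : IsRepresentable α p law → NoInteriorGap d m := by
    intro hrep
    rw [noInteriorGap_iff hh hp]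
    by_cases hsymm : IsSymmetricMeasure law
    · obtain ⟨Γ, hΓC, hΓ, hEq⟩ := (hrep.2 hsymm).exists_moments hs hlaw
      exact eq_zero_of_moments_eq hα₀ hα₂ hσ _ hT hx hΓC hΓ hEq
    · obtain ⟨Γ, hΓC, hΓ, -, hEq⟩ := (hrep.1 hsymm).exists_moments hα₀ hs hlaw
      exact eq_zero_of_moments_eq hα₀ hα₂ hσ _ hT hx hΓC hΓ hEq
  refine ⟨fun hcase => ⟨hgap, fun hG => ⟨fun hsymm => ?_, fun hsymm => ?_⟩⟩,
    fun hα1 hβ hsymm => ⟨fun hrep => ⟨hgap hrep, ?_⟩, fun hG => ⟨fun _ => ?_, fun h => absurd h hsymm⟩⟩⟩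
  -- For `β = 0` the characteristic function is even, so a non-symmetric law leaves only `α ≠ 1`
  -- among the three alternatives.
  · have hα1 : α ≠ 1 := by
      rcases hcase with h1 | rfl | h1
      · exact h1
      · refine absurd (isSymmetricMeasure_of_charFun_neg fun u => ?_) hsymm
        rw [hlaw, hlaw]
        simp [stableExponent]
      · exact absurd h1 hsymm
    refine isRepresentableAsymm_of_charFun hα₀ hβ₁ hβ₂ hσ ((noInteriorGap_iff hh hp).1 hG)
      (hE (Or.inl hα1)) ?_ hlaw
    simp [logScale, hα1, summable_zero]
  · exact isRepresentableSymm_of_charFun hα₀ hσ ((noInteriorGap_iff hh hp).1 hG) hx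
      (charFun_eq_exp_of_isSymmetricMeasure hα₀ hsymm hx hs hlaw)
  · obtain ⟨Γ, hΓC, hΓ, hlog, hEq⟩ := (hrep.1 hsymm).exists_moments hα₀ hs hlaw
    subst hα1
    obtain ⟨δ, hδ, hTδ⟩ := Seminorm.exists_le_norm_proj hT headProj_headProj
    obtain ⟨M, hM, hTM⟩ := Seminorm.exists_norm_proj_le hT headProj_headProj
    simp only [Real.rpow_one] at hΓ hEq hcα
    exact summable_norm_mul_log_div hσ _ hδ hM hTδ hTM hcα ((noInteriorGap_iff hh hp).1 (hgap hrep))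
      hΓC hΓ (hlog rfl) hEq
  · subst hα1
    have hpc := (noInteriorGap_iff hh hp).1 hG.1
    refine isRepresentableAsymm_of_charFun hα₀ hβ₁ hβ₂ hσ hpc (hE (Or.inr hβ)) ?_ hlaw
    simp only [logScale, if_true]
    exact summable_log_seminorm_mul_norm hpc (hd.summable_norm_coeffVector_mul_log hβ m h) hG.2
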